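/- Let $a,M\in\mathbb R$ with $a\neq 0$ and $|a|<M$, and put $r_+=M+\sqrt{M^2-a^2}$. Let $D=\{r>r_+\}\cong\mathbb R_t\times(r_+,\infty)_r\times S^2$ be the domain of outer communication of the Kerr spacetime of mass $M$ and specific angular momentum $a$, with the metric which in Boyer--Lindquist coordinates $(t,r,\vartheta,\varphi)$ is $$g=-\Big(1-\frac{2Mr}{\rho^2}\Big)dt^2+\frac{\rho^2}{\Delta}dr^2+\rho^2d\vartheta^2-\frac{4Mra\sin^2\vartheta}{\rho^2}\,dt\,d\varphi+\frac{(r^2+a^2)^2-\Delta a^2\sin^2\vartheta}{\rho^2}\sin^2\vartheta\,d\varphi^2,$$ where $\rho^2=r^2+a^2\cos^2\vartheta$ and $\Delta=r^2-2Mr+a^2$, extended smoothly over the axis $\{\sin\vartheta=0\}$. (1) There is no nonempty (immersed) smooth hypersurface $\mathscr S$ of $D$ such that $\mathscr S$ is timelike (its induced metric is Lorentzian), umbilical (at each point its second fundamental form is a multiple of its first fundamental form) and null geodesically complete (every inextendible null geodesic of $\mathscr S$ with the induced metric is defined on all of $\mathbb R$), and such that the image of $\mathscr S$ in the quotient of $D$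 by the flow of the stationary Killing vector field $\partial_t$ is contained in a compact subset of this quotient. (2) In particular, for no $r_0>r_+$ is the cylinder $\{r=r_0\}\subset D$ umbilical. -/

import Mathlib

open scoped Manifold ContDiff

noncomputable section

namespace Kerr

/-! ### Levi-Civita calculus in a linear coordinate domain -/

section Calculus

variable {E : Type*} [NormedAddCommGroup E] [NormedSpace ℝ E]

/-- Christoffel symbols of the first kind of a metric `g` given on (an open subset of) the vector
space `E`: `g(Γ(v,w), z) = (∂_v g(w,z) + ∂_w g(v,z) - ∂_z g(v,w)) / 2`. -/
def christoffelFirst (g : E → E → E → ℝ) (x v w z : E) : ℝ :=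
  (fderiv ℝ (fun y => g y w z) x v + fderiv ℝ (fun y => g y v z) x w
    - fderiv ℝ (fun y => g y v w) x z) / 2

/-- A symmetric bilinear form of signature `(-,+,+)` on a three-dimensional space. -/
def IsLorentzian₃ (b : E → E → ℝ) : Prop :=
  ∃ e : Module.Basis (Fin 3) ℝ E, ∀ i j : Fin 3,
    b (e i) (e j) = if i = j then (if i = 0 then -1 else 1) else 0

end Calculus

/-! ### The domain of outer communication -/

/-- Global coordinates `(t, x)`, where `x = r (sin ϑ cos φ, sin ϑ sin φ, cos ϑ)` in terms of the
Boyer–Lindquist coordinates `(t, r, ϑ, φ)`. They also cover the axis `sin ϑ = 0`. -/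
abbrev Spacetime : Type := ℝ × EuclideanSpace ℝ (Fin 3)

/-- The Boyer–Lindquist radius. -/
def radius (p : Spacetime) : ℝ := ‖p.2‖

/-- The radius of the outer horizon. -/
def horizonRadius (M a : ℝ) : ℝ := M + √(M ^ 2 - a ^ 2)

/-- The domain of outer communication `{r > M + √(M² - a²)}`. -/
def DOC (M a : ℝ) : Set Spacetime := {p | horizonRadius M a < radius p}

/-- `cos ϑ` -/
def cosTheta (p : Spacetime) : ℝ := p.2 2 / radius p

/-- `ρ² = r² + a² cos² ϑ` -/
def rhoSq (a : ℝ) (p : Spacetime) : ℝ := radius p ^ 2 + a ^ 2 * cosTheta p ^ 2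

/-- `Δ = r² - 2 M r + a²` -/
def Delta (M a : ℝ) (p : Spacetime) : ℝ := radius p ^ 2 - 2 * M * radius p + a ^ 2

/-- The one-form `dr`. -/
def dr (p v : Spacetime) : ℝ := inner ℝ p.2 v.2 / radius p

/-- The one-form `sin² ϑ dφ`, smooth across the axis. -/
def sinSqDphi (p v : Spacetime) : ℝ := (p.2 0 * v.2 1 - p.2 1 * v.2 0) / radius p ^ 2

/-- The round metric `dϑ² + sin² ϑ dφ²` of the unit sphere. -/
def roundMetric (p v w : Spacetime) : ℝ :=
  (inner ℝ v.2 w.2 - dr p v * dr p w) / radius p ^ 2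

/-- The Kerr metric of mass `M` and specific angular momentum `a` (see `metric_boyerLindquist` for
its Boyer–Lindquist form). The last two summands use
`(𝒜/ρ²) sin² ϑ dφ² = ρ² sin² ϑ dφ² + a² (1 + 2 M r / ρ²) (sin² ϑ dφ)²`. -/
def metric (M a : ℝ) (p v w : Spacetime) : ℝ :=
  -(1 - 2 * M * radius p / rhoSq a p) * (v.1 * w.1)
    + rhoSq a p / Delta M a p * (dr p v * dr p w)
    - 2 * M * radius p * a / rhoSq a p * (v.1 * sinSqDphi p w + sinSqDphi p v * w.1)
    + rhoSq a p * roundMetric p v w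
    + a ^ 2 * (1 + 2 * M * radius p / rhoSq a p) * (sinSqDphi p v * sinSqDphi p w)

/-- The Boyer–Lindquist coordinate map `(t, r, ϑ, φ) ↦ (t, x)`. -/
def boyerLindquist (t r θ φ : ℝ) : Spacetime :=
  (t, !₂[r * (Real.sin θ * Real.cos φ), r * (Real.sin θ * Real.sin φ), r * Real.cos θ])

/-- In Boyer–Lindquist coordinates the square of the velocity `(ṫ, ṙ, ϑ̇, φ̇)` of a curve is given
by the usual expression
`-(1 - 2Mr/ρ²) dt² + (ρ²/Δ) dr² + ρ² dϑ² - (4Mra sin²ϑ/ρ²) dt dφ + (𝒜/ρ²) sin²ϑ dφ²`. -/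
theorem metric_boyerLindquist (M a : ℝ) {t r θ φ : ℝ → ℝ} {s t' r' θ' φ' : ℝ}
    (ht : HasDerivAt t t' s) (hr : HasDerivAt r r' s) (hθ : HasDerivAt θ θ' s)
    (hφ : HasDerivAt φ φ' s) (hpos : 0 < r s) :
    ∃ v : Spacetime,
      HasDerivAt (fun s => boyerLindquist (t s) (r s) (θ s) (φ s)) v s ∧
      ∀ ρ2 Δ A : ℝ, ρ2 = r s ^ 2 + a ^ 2 * Real.cos (θ s) ^ 2 →
        Δ = r s ^ 2 - 2 * M * r s + a ^ 2 →
        A = (r s ^ 2 + a ^ 2) ^ 2 - Δ * a ^ 2 * Real.sin (θ s) ^ 2 →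
        metric M a (boyerLindquist (t s) (r s) (θ s) (φ s)) v v =
          -(1 - 2 * M * r s / ρ2) * t' ^ 2 + ρ2 / Δ * r' ^ 2 + ρ2 * θ' ^ 2
            - 4 * M * r s * a * Real.sin (θ s) ^ 2 / ρ2 * (t' * φ')
            + A / ρ2 * Real.sin (θ s) ^ 2 * φ' ^ 2 := by
  have hrad : ∀ r θ φ : ℝ, 0 < r → ∀ t, radius (boyerLindquist t r θ φ) = r := by
    intro r θ φ h t
    simp only [radius, boyerLindquist, EuclideanSpace.norm_eq, Fin.sum_univ_three,
      Real.norm_eq_abs, sq_abs]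
    rw [Real.sqrt_eq_iff_eq_sq (by positivity) h.le]
    simp
    linear_combination r ^ 2 * Real.sin θ ^ 2 * Real.sin_sq_add_cos_sq φ
      + r ^ 2 * Real.sin_sq_add_cos_sq θ
  set v : Spacetime := (t', !₂[r' * (Real.sin (θ s) * Real.cos (φ s))
      + r s * (Real.cos (θ s) * θ' * Real.cos (φ s) + Real.sin (θ s) * (-Real.sin (φ s) * φ')),
    r' * (Real.sin (θ s) * Real.sin (φ s))
      + r s * (Real.cos (θ s) * θ' * Real.sin (φ s) + Real.sin (θ s) * (Real.cos (φ s) * φ')),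
    r' * Real.cos (θ s) + r s * (-Real.sin (θ s) * θ')]) with hv
  refine ⟨v, ?_, ?_⟩
  · refine ht.prodMk ?_
    rw [← hasDerivWithinAt_univ, hasDerivWithinAt_iff_hasFDerivWithinAt,
      hasFDerivWithinAt_euclidean]
    intro i
    rw [hasFDerivWithinAt_univ, hasFDerivAt_iff_hasDerivAt]
    fin_cases i
    · simpa using hr.fun_mul (hθ.sin.fun_mul hφ.cos)
    · simpa using hr.fun_mul (hθ.sin.fun_mul hφ.sin)
    · simpa using hr.fun_mul hθ.cos
  · rintro ρ2 Δ A hρ hΔ hA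
    have hne : r s ≠ 0 := hpos.ne'
    have e1 := Real.sin_sq_add_cos_sq (θ s)
    have e2 := Real.sin_sq_add_cos_sq (φ s)
    set p := boyerLindquist (t s) (r s) (θ s) (φ s) with hp
    have hR : radius p = r s := hrad _ _ _ hpos _
    have hρpos : 0 < r s ^ 2 + a ^ 2 * Real.cos (θ s) ^ 2 := by positivity
    have h1 : rhoSq a p = ρ2 := by
      simp only [rhoSq, cosTheta, hR, hρ]
      simp only [hp, boyerLindquist]
      simp
      field_simp
      simp
    have h2 : Delta M a p = Δ := by simp only [Delta, hR, hΔ]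
    have h3 : dr p v = r' := by
      simp only [dr, hR]
      rw [div_eq_iff hne]
      simp [hp, hv, boyerLindquist, PiLp.inner_apply, Fin.sum_univ_three]
      linear_combination (r' * r s * Real.sin (θ s) ^ 2
        + r s ^ 2 * Real.sin (θ s) * Real.cos (θ s) * θ') * e2 + r' * r s * e1
    have h4 : sinSqDphi p v = Real.sin (θ s) ^ 2 * φ' := by
      simp only [sinSqDphi, hR]
      rw [div_eq_iff (by positivity)]
      simp [hp, hv, boyerLindquist]
      linear_combination (r s ^ 2 * Real.sin (θ s) ^ 2 * φ') * e2
    have h5 : roundMetric p v v = θ' ^ 2 + Real.sin (θ s) ^ 2 * φ' ^ 2 := by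
      simp only [roundMetric, hR, h3]
      rw [div_eq_iff (by positivity), PiLp.inner_apply, Fin.sum_univ_three]
      simp only [hv, RCLike.inner_apply, conj_trivial, PiLp.toLp_apply, Matrix.cons_val]
      generalize Real.sin (θ s) = S at *
      generalize Real.cos (θ s) = C at *
      linear_combination ((r' * S + r s * C * θ') ^ 2 + r s ^ 2 * S ^ 2 * φ' ^ 2) * e2
        + (r' ^ 2 + r s ^ 2 * θ' ^ 2) * e1
    have hρ0 : ρ2 ≠ 0 := by rw [hρ]; exact hρpos.ne'
    have hA2 : A = ρ2 ^ 2 + a ^ 2 * Real.sin (θ s) ^ 2 * (ρ2 + 2 * M * r s) := by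
      rw [hA, hΔ, hρ]
      have : Real.cos (θ s) ^ 2 = 1 - Real.sin (θ s) ^ 2 := by linarith
      rw [this]; ring
    simp only [metric, h1, h2, h3, h4, h5, hR, hA2]
    generalize Real.sin (θ s) = S
    have : v.1 = t' := rfl
    rw [this]
    field_simp
    ring

/-! ### Hypersurfaces -/

section Hypersurface

variable {E : Type*} [NormedAddCommGroup E] [NormedSpace ℝ E]
  {H : Type*} [TopologicalSpace H] (I : ModelWithCorners ℝ E H)
  {N : Type*} [TopologicalSpace N] [ChartedSpace H N]

/-- The map `f : N → Spacetime` in the chart of `N` around `p`. -/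
def localRep (f : N → Spacetime) (p : N) : E → Spacetime := f ∘ (extChartAt I p).symm

/-- The induced metric (first fundamental form) `f^* g` in the chart of `N` around `p`, at the
point with coordinates `u`. -/
def inducedMetric (M a : ℝ) (f : N → Spacetime) (p : N) (u v w : E) : ℝ :=
  metric M a (localRep I f p u) (fderiv ℝ (localRep I f p) u v) (fderiv ℝ (localRep I f p) u w)

/-- `f` is a smooth immersion of the manifold `N` into the domain of outer communication. -/
structure IsImmersedIn (M a : ℝ) (f : N → Spacetime) : Prop where
  smooth : ContMDiff I 𝓘(ℝ, Spacetime) ∞ f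
  immersion : ∀ p, Function.Injective (mfderiv I 𝓘(ℝ, Spacetime) f p)
  mem_DOC : ∀ p, f p ∈ DOC M a

/-- The immersed hypersurface `f` is timelike: the induced metric is Lorentzian everywhere. -/
def IsTimelike (M a : ℝ) (f : N → Spacetime) : Prop :=
  ∀ p, IsLorentzian₃ (inducedMetric I M a f p (extChartAt I p p))

/-- The component `g(∇_v (df w), n)` of the second fundamental form of `f` at `p` along a vector
`n` normal to the hypersurface; `v` and `w` are tangent vectors in the chart around `p`. -/
def secondFundamentalForm (M a : ℝ) (f : N → Spacetime) (p : N) (n : Spacetime) (v w : E) : ℝ :=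
  metric M a (f p) (fderiv ℝ (fderiv ℝ (localRep I f p)) (extChartAt I p p) v w) n
    + christoffelFirst (metric M a) (f p)
        (fderiv ℝ (localRep I f p) (extChartAt I p p) v)
        (fderiv ℝ (localRep I f p) (extChartAt I p p) w) n

/-- `f` is (totally) umbilical: at every point the second fundamental form along every normal
vector is a multiple of the first fundamental form. -/
def IsUmbilical (M a : ℝ) (f : N → Spacetime) : Prop :=
  ∀ (p : N) (n : Spacetime),
    (∀ v : E, metric M a (f p) (fderiv ℝ (localRep I f p) (extChartAt I p p) v) n = 0) →
    ∃ c : ℝ, ∀ v w : E, secondFundamentalForm I M a f p n v w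
      = c * inducedMetric I M a f p (extChartAt I p p) v w

/-- `γ` is, on the open set `J` of parameters, a null geodesic of the manifold `N` with the metric
induced by `f`: at each time `s`, its representation `c` in the chart around `γ s` satisfies
`h(c'' + Γ(c', c'), z) = 0` for all `z`, with `h` the induced metric and `Γ` its Christoffel
symbols, and `c'` is a nonzero null vector. -/
structure IsNullGeodesicOn (M a : ℝ) (f : N → Spacetime) (γ : ℝ → N) (J : Set ℝ) : Prop where
  smooth : ContMDiffOn 𝓘(ℝ, ℝ) I ∞ γ J
  geodesic : ∀ s ∈ J, ∀ z : E,
    inducedMetric I M a f (γ s) (extChartAt I (γ s) (γ s))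
        (deriv (deriv (extChartAt I (γ s) ∘ γ)) s) z
      + christoffelFirst (inducedMetric I M a f (γ s)) (extChartAt I (γ s) (γ s))
          (deriv (extChartAt I (γ s) ∘ γ) s) (deriv (extChartAt I (γ s) ∘ γ) s) z = 0
  velocity_ne_zero : ∀ s ∈ J, deriv (extChartAt I (γ s) ∘ γ) s ≠ 0
  null : ∀ s ∈ J, inducedMetric I M a f (γ s) (extChartAt I (γ s) (γ s))
    (deriv (extChartAt I (γ s) ∘ γ) s) (deriv (extChartAt I (γ s) ∘ γ) s) = 0

/-- Nonempty open intervals, bounded or not. -/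
def IsOpenInterval (J : Set ℝ) : Prop := IsOpen J ∧ J.OrdConnected ∧ J.Nonempty

/-- A null geodesic on the interval `J` that has no extension to a larger open interval. -/
def IsInextendibleNullGeodesic (M a : ℝ) (f : N → Spacetime) (γ : ℝ → N) (J : Set ℝ) : Prop :=
  IsOpenInterval J ∧ IsNullGeodesicOn I M a f γ J ∧
    ∀ (γ' : ℝ → N) (J' : Set ℝ), IsOpenInterval J' → J ⊆ J' → Set.EqOn γ' γ J →
      IsNullGeodesicOn I M a f γ' J' → J' = J

/-- Null geodesic completeness of `N` with the induced metric: every inextendible null geodesic is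
defined on all of `ℝ`. -/
def IsNullGeodesicallyComplete (M a : ℝ) (f : N → Spacetime) : Prop :=
  ∀ (γ : ℝ → N) (J : Set ℝ), IsInextendibleNullGeodesic I M a f γ J → J = Set.univ

end Hypersurface

/-- The image of `f` in the quotient of the domain of outer communication by the flow
`(t, x) ↦ (t + s, x)` of `∂_t`, that is, in `{x | M + √(M² - a²) < ‖x‖}`, lies in a compact
subset of this quotient. -/
def HasCompactlyBoundedQuotient {N : Type*} (M a : ℝ) (f : N → Spacetime) : Prop :=
  ∃ K : Set (EuclideanSpace ℝ (Fin 3)), IsCompact K ∧ K ⊆ {x | horizonRadius M a < ‖x‖} ∧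
    ∀ p, (f p).2 ∈ K

/-- The inclusion of the cylinder `{r = r₀}`, written as `ℝ × S²`. -/
def cylinder (r₀ : ℝ) : ℝ × Metric.sphere (0 : EuclideanSpace ℝ (Fin 3)) 1 → Spacetime :=
  fun q => (q.1, r₀ • (q.2 : EuclideanSpace ℝ (Fin 3)))

end Kerr

end

/-! On null vectors the second fundamental form of an umbilical hypersurface vanishes, so the null
geodesics of the hypersurface are null geodesics of Kerr (`accel_eq_zero`). By completeness and the
compactness of the quotient image, each of them is defined on all of `ℝ` and its radius stays in
some `[r₁, r₂]` with `r₁ > r₊`.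

Such a geodesic has constant radius (`dr_velocity_eq_zero`). Let `E` be its energy, `L` its axial
angular momentum, `P = (r² + a²)E - aL` and `W = ρ² r'/√Δ`. Then `r' = (√Δ/ρ²) W` and `W' = P
G/(Δ^{3/2} ρ²)`, where `G = (2P'Δ - PΔ')/2`. This is obtained from the Lie derivative of the metric
along `r ∂_r`, a virial identity which makes Carter's constant unnecessary. On a null geodesic `P`
has no zero, and `E G/(r - M)` is nondecreasing, so `P G` has the sign of `r - c` for a suitable
`c`: spherical photon orbits are unstable (`exists_repelling_radius`). A bounded motion repelled
from `c` for all times, past and future, must be stationary (`repelled_eq_zero`).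

Hence all null vectors of the hypersurface are annihilated by `dr`. Null vectors span a Lorentzian
tangent space, so the hypersurface is tangent to the level sets of `r` (`dr_tangent_eq_zero`). Its
second fundamental form along the normal `r ∂_r` is then `-1/2` times the Lie derivative of the
metric (`secondFundamentalForm_scalingField`). Off the axis, proportionality to the metric fails:
the `∂_ϑ` direction and the mixed `∂_t`, `∂_φ` component would together force `ρ² = 4r²`, while `ρ²
≤ r² + a² < 2r²` (`lieScaling_not_proportional`). The mixed component gives information because `a ≠
0`. The cylinders satisfy `dr = 0` from the outset, so this last step alone excludes them. -/

set_option linter.unusedSectionVars false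

noncomputable section

namespace Kerr

/-! ### Bilinear forms along curves -/

section Calculus

variable {E : Type*} [NormedAddCommGroup E] [NormedSpace ℝ E]

/-- Product rule for a field of bilinear forms evaluated along a curve. -/
theorem hasDerivAt_bilin {G : E → E →L[ℝ] E →L[ℝ] ℝ} {x v w : ℝ → E} {x' v' w' : E} {s : ℝ}
    (hG : DifferentiableAt ℝ G (x s)) (hx : HasDerivAt x x' s) (hv : HasDerivAt v v' s)
    (hw : HasDerivAt w w' s) :
    HasDerivAt (fun s => G (x s) (v s) (w s))
      (fderiv ℝ G (x s) x' (v s) (w s) + G (x s) v' (w s) + G (x s) (v s) w') s := by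
  have h1 : HasDerivAt (fun s => G (x s)) (fderiv ℝ G (x s) x') s :=
    HasFDerivAt.comp_hasDerivAt (l := G) (l' := fderiv ℝ G (x s)) (f := x) s hG.hasFDerivAt hx
  have h2 : HasDerivAt (fun s => G (x s) (v s)) (fderiv ℝ G (x s) x' (v s) + G (x s) v') s :=
    h1.clm_apply hv
  exact h2.clm_apply hw

theorem fderiv_bilin_apply {F : Type*} [NormedAddCommGroup F] [NormedSpace ℝ F]
    {G : F → E →L[ℝ] E →L[ℝ] ℝ} {x : F}
    (hG : DifferentiableAt ℝ G x) (v w : E) (z : F) :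
    fderiv ℝ (fun y => G y v w) x z = fderiv ℝ G x z v w := by
  have h := ((hG.hasFDerivAt.clm_apply (hasFDerivAt_const v x)).clm_apply (hasFDerivAt_const w x))
  rw [h.fderiv]
  simp

theorem christoffelFirst_eq {G : E → E →L[ℝ] E →L[ℝ] ℝ} {g : E → E → E → ℝ}
    (hg : ∀ y v w, g y v w = G y v w) {x : E} (hG : DifferentiableAt ℝ G x) (v w z : E) :
    christoffelFirst g x v w z
      = (fderiv ℝ G x v w z + fderiv ℝ G x w v z - fderiv ℝ G x z v w) / 2 := by
  obtain rfl : g = fun y v w => G y v w := by funext y v w; exact hg y v w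
  simp only [christoffelFirst, fderiv_bilin_apply hG]

end Calculus

/-! ### The Kerr metric as a smooth field of bilinear forms -/

theorem dr_add (p v w : Spacetime) : dr p (v + w) = dr p v + dr p w := by
  simp [dr, inner_add_right, add_div]

theorem dr_smul (p : Spacetime) (c : ℝ) (v : Spacetime) : dr p (c • v) = c * dr p v := by
  simp [dr, inner_smul_right, mul_div_assoc]

theorem sinSqDphi_add (p v w : Spacetime) :
    sinSqDphi p (v + w) = sinSqDphi p v + sinSqDphi p w := by
  simp [sinSqDphi]; ring

theorem sinSqDphi_smul (p : Spacetime) (c : ℝ) (v : Spacetime) :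
    sinSqDphi p (c • v) = c * sinSqDphi p v := by
  simp [sinSqDphi]; ring

theorem roundMetric_comm (p v w : Spacetime) : roundMetric p v w = roundMetric p w v := by
  simp only [roundMetric, real_inner_comm, mul_comm]

theorem roundMetric_add (p u v w : Spacetime) :
    roundMetric p (u + v) w = roundMetric p u w + roundMetric p v w := by
  simp only [roundMetric, dr_add, Prod.snd_add, inner_add_left]; ring

theorem roundMetric_smul (p : Spacetime) (c : ℝ) (v w : Spacetime) :
    roundMetric p (c • v) w = c * roundMetric p v w := by
  simp only [roundMetric, dr_smul, Prod.smul_snd, real_inner_smul_left]; ring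

/-- The Kerr metric with the mixed terms collected in the form `dt - a sin² ϑ dφ`. -/
theorem metric_eq (M a : ℝ) (p v w : Spacetime) :
    metric M a p v w = -(v.1 * w.1)
      + 2 * M * radius p / rhoSq a p
        * ((v.1 - a * sinSqDphi p v) * (w.1 - a * sinSqDphi p w))
      + a ^ 2 * (sinSqDphi p v * sinSqDphi p w) + rhoSq a p * roundMetric p v w
      + rhoSq a p / Delta M a p * (dr p v * dr p w) := by
  simp only [metric]; ring

theorem metric_comm (M a : ℝ) (p v w : Spacetime) : metric M a p v w = metric M a p w v := by
  simp only [metric_eq, roundMetric_comm p v w]; ring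

theorem metric_add (M a : ℝ) (p u v w : Spacetime) :
    metric M a p (u + v) w = metric M a p u w + metric M a p v w := by
  simp only [metric_eq, roundMetric_add, dr_add, sinSqDphi_add, Prod.fst_add]; ring

theorem metric_smul (M a : ℝ) (p : Spacetime) (c : ℝ) (v w : Spacetime) :
    metric M a p (c • v) w = c * metric M a p v w := by
  simp only [metric_eq, roundMetric_smul, dr_smul, sinSqDphi_smul, Prod.smul_fst, smul_eq_mul]
  ring

/-- The Kerr metric as a continuous bilinear form. -/
def metricCLM (M a : ℝ) (p : Spacetime) : Spacetime →L[ℝ] Spacetime →L[ℝ] ℝ :=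
  LinearMap.toContinuousBilinearMap
    (LinearMap.mk₂ ℝ (metric M a p) (metric_add M a p) (metric_smul M a p)
      (fun u v w => by rw [metric_comm, metric_add, metric_comm M a p v, metric_comm M a p w])
      (fun c v w => by rw [metric_comm, metric_smul, metric_comm]; rfl))

theorem metricCLM_apply (M a : ℝ) (p v w : Spacetime) :
    metricCLM M a p v w = metric M a p v w := rfl

theorem metricCLM_comm (M a : ℝ) (p v w : Spacetime) :
    metricCLM M a p v w = metricCLM M a p w v := metric_comm M a p v w

/-! ### Positivity and smoothness in the domain of outer communication. -/

section Domain

variable {M a : ℝ}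

theorem sq_lt_sq_of_abs_lt (haM : |a| < M) : 0 < M ^ 2 - a ^ 2 := by
  have := abs_nonneg a
  nlinarith [sq_abs a]

theorem mass_lt_of_horizonRadius_lt (haM : |a| < M) {r : ℝ} (hr : horizonRadius M a < r) :
    M < r := by
  have := Real.sqrt_pos.2 (sq_lt_sq_of_abs_lt haM)
  unfold horizonRadius at hr
  linarith

theorem Delta_pos_of_horizonRadius_lt (haM : |a| < M) {r : ℝ} (hr : horizonRadius M a < r) :
    0 < r ^ 2 - 2 * M * r + a ^ 2 := by
  have h := sq_lt_sq_of_abs_lt haM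
  have h1 := Real.sqrt_pos.2 h
  have h2 := Real.sq_sqrt h.le
  unfold horizonRadius at hr
  nlinarith

theorem radius_gt_mass (haM : |a| < M) {p : Spacetime} (hp : p ∈ DOC M a) : M < radius p :=
  mass_lt_of_horizonRadius_lt haM hp

theorem mass_pos (haM : |a| < M) : 0 < M := (abs_nonneg a).trans_lt haM

theorem radius_pos (haM : |a| < M) {p : Spacetime} (hp : p ∈ DOC M a) : 0 < radius p :=
  (mass_pos haM).trans (radius_gt_mass haM hp)

theorem Delta_pos (haM : |a| < M) {p : Spacetime} (hp : p ∈ DOC M a) : 0 < Delta M a p :=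
  Delta_pos_of_horizonRadius_lt haM hp

theorem rhoSq_pos {p : Spacetime} (hp : 0 < radius p) : 0 < rhoSq a p := by
  unfold rhoSq; positivity

theorem isOpen_DOC : IsOpen (DOC M a) :=
  isOpen_lt continuous_const (by unfold radius; fun_prop)

theorem contDiffAt_radius {p : Spacetime} (hp : 0 < radius p) : ContDiffAt ℝ ∞ radius p :=
  ContDiffAt.norm ℝ contDiffAt_snd (norm_pos_iff.1 hp)

theorem contDiffAt_coord (i : Fin 3) (p : Spacetime) :
    ContDiffAt ℝ ∞ (fun q : Spacetime => q.2 i) p :=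
  ((EuclideanSpace.proj i : EuclideanSpace ℝ (Fin 3) →L[ℝ] ℝ).comp
    (ContinuousLinearMap.snd ℝ ℝ _)).contDiff.contDiffAt

theorem contDiffAt_rhoSq {p : Spacetime} (hp : 0 < radius p) : ContDiffAt ℝ ∞ (rhoSq a) p := by
  have h1 := contDiffAt_radius hp
  have h2 := contDiffAt_coord 2 p
  unfold rhoSq cosTheta
  exact (h1.pow 2).add (contDiffAt_const.mul ((h2.div h1 hp.ne').pow 2))

theorem contDiffAt_Delta {p : Spacetime} (hp : 0 < radius p) : ContDiffAt ℝ ∞ (Delta M a) p := by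
  have h1 := contDiffAt_radius hp
  unfold Delta
  exact ((h1.pow 2).sub (contDiffAt_const.mul h1)).add contDiffAt_const

theorem contDiffAt_dr {p : Spacetime} (hp : 0 < radius p) (v : Spacetime) :
    ContDiffAt ℝ ∞ (fun q => dr q v) p := by
  have h1 := contDiffAt_radius hp
  unfold dr
  exact (contDiffAt_snd.inner ℝ contDiffAt_const).div h1 hp.ne'

theorem contDiffAt_sinSqDphi {p : Spacetime} (hp : 0 < radius p) (v : Spacetime) :
    ContDiffAt ℝ ∞ (fun q => sinSqDphi q v) p := by
  have h1 := contDiffAt_radius hp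
  unfold sinSqDphi
  exact (((contDiffAt_coord 0 p).mul contDiffAt_const).sub
    ((contDiffAt_coord 1 p).mul contDiffAt_const)).div (h1.pow 2) (pow_ne_zero 2 hp.ne')

theorem contDiffAt_roundMetric {p : Spacetime} (hp : 0 < radius p) (v w : Spacetime) :
    ContDiffAt ℝ ∞ (fun q => roundMetric q v w) p := by
  have h1 := contDiffAt_radius hp
  unfold roundMetric
  exact (contDiffAt_const.sub ((contDiffAt_dr hp v).mul (contDiffAt_dr hp w))).div (h1.pow 2)
    (pow_ne_zero 2 hp.ne')

/-- In the Cartesian-type coordinates the only denominators are `r`, `ρ²` and `Δ`, all positive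
here, so the axis needs no separate treatment. -/
theorem contDiffAt_metric (haM : |a| < M) {p : Spacetime} (hp : p ∈ DOC M a) (v w : Spacetime) :
    ContDiffAt ℝ ∞ (fun q => metric M a q v w) p := by
  have hr := radius_pos haM hp
  have h1 := contDiffAt_radius hr
  have h2 := contDiffAt_rhoSq (a := a) hr
  have h3 := contDiffAt_Delta (M := M) (a := a) hr
  have hρ := (rhoSq_pos (a := a) hr).ne'
  have hσ := contDiffAt_sinSqDphi hr
  simp only [metric_eq]
  exact (((contDiffAt_const.add (((contDiffAt_const.mul h1).div h2 hρ).mul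
    ((contDiffAt_const.sub (contDiffAt_const.mul (hσ v))).mul
      (contDiffAt_const.sub (contDiffAt_const.mul (hσ w)))))).add
    (contDiffAt_const.mul ((hσ v).mul (hσ w)))).add (h2.mul (contDiffAt_roundMetric hr v w))).add
    ((h2.div h3 (Delta_pos haM hp).ne').mul ((contDiffAt_dr hr v).mul (contDiffAt_dr hr w)))

theorem contDiffOn_metricCLM (haM : |a| < M) : ContDiffOn ℝ ∞ (metricCLM M a) (DOC M a) :=
  contDiffOn_clm_apply.2 fun v => contDiffOn_clm_apply.2 fun w _ hp =>
    (contDiffAt_metric haM hp v w).contDiffWithinAt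

theorem contDiffAt_metricCLM (haM : |a| < M) {p : Spacetime} (hp : p ∈ DOC M a) :
    ContDiffAt ℝ ∞ (metricCLM M a) p :=
  (contDiffOn_metricCLM haM).contDiffAt (isOpen_DOC.mem_nhds hp)

theorem differentiableAt_metricCLM (haM : |a| < M) {p : Spacetime} (hp : p ∈ DOC M a) :
    DifferentiableAt ℝ (metricCLM M a) p :=
  (contDiffAt_metricCLM haM hp).differentiableAt (by simp)

end Domain

/-! ### Killing fields and the radial scaling field -/

/-- The vector field `∂_t`. -/
def timeField : Spacetime := (1, 0)

/-- The vector field `r ∂_r`, that generates the scalings `(t, x) ↦ (t, l x)`. -/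
def scalingField : Spacetime →L[ℝ] Spacetime :=
  (ContinuousLinearMap.inr ℝ ℝ _).comp (ContinuousLinearMap.snd ℝ ℝ _)

/-- The vector field `∂_φ`, that generates the rotations about the axis. -/
def axialField : Spacetime →L[ℝ] Spacetime :=
  LinearMap.toContinuousLinearMap
    { toFun := fun p => (0, !₂[-p.2 1, p.2 0, 0])
      map_add' := fun p q => by
        ext i
        · simp
        · fin_cases i <;> simp; ring
      map_smul' := fun c p => by
        ext i
        · simp
        · fin_cases i <;> simp }

theorem scalingField_apply (p : Spacetime) : scalingField p = (0, p.2) := rfl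

theorem axialField_apply (p : Spacetime) : axialField p = (0, !₂[-p.2 1, p.2 0, 0]) := rfl

section Fields

variable {p v w : Spacetime}

theorem radius_sq (p : Spacetime) : radius p ^ 2 = p.2 0 ^ 2 + p.2 1 ^ 2 + p.2 2 ^ 2 := by
  simp [radius, EuclideanSpace.norm_sq_eq, Fin.sum_univ_three]

theorem inner_eq (x y : EuclideanSpace ℝ (Fin 3)) :
    inner ℝ x y = x 0 * y 0 + x 1 * y 1 + x 2 * y 2 := by
  simp [PiLp.inner_apply, Fin.sum_univ_three, mul_comm]

theorem dr_timeField : dr p timeField = 0 := by simp [dr, timeField]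
theorem sinSqDphi_timeField : sinSqDphi p timeField = 0 := by simp [sinSqDphi, timeField]
theorem roundMetric_timeField : roundMetric p v timeField = 0 := by
  simp [roundMetric, dr_timeField]; simp [timeField]

theorem dr_axialField : dr p (axialField p) = 0 := by
  simp [dr, axialField_apply, inner_eq]; left; ring
theorem sinSqDphi_axialField :
    sinSqDphi p (axialField p) = (p.2 0 ^ 2 + p.2 1 ^ 2) / radius p ^ 2 := by
  simp [sinSqDphi, axialField_apply]; ring
theorem roundMetric_axialField : roundMetric p v (axialField p) = sinSqDphi p v := by
  simp [roundMetric, dr_axialField, sinSqDphi]; simp [axialField_apply, inner_eq]; ring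

theorem dr_scalingField (hp : 0 < radius p) : dr p (scalingField p) = radius p := by
  rw [dr, scalingField_apply, real_inner_self_eq_norm_sq, ← radius]
  field_simp
theorem sinSqDphi_scalingField : sinSqDphi p (scalingField p) = 0 := by
  simp [sinSqDphi, scalingField_apply]; left; ring
theorem roundMetric_scalingField (hp : 0 < radius p) :
    roundMetric p v (scalingField p) = 0 := by
  rw [roundMetric, dr_scalingField hp, dr, scalingField_apply]
  rw [real_inner_comm]
  field_simp
  simp

theorem metric_timeField (M a : ℝ) : metric M a p v timeField =
    -(v.1 - 2 * M * radius p / rhoSq a p * (v.1 - a * sinSqDphi p v)) := by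
  simp only [metric_eq, dr_timeField, sinSqDphi_timeField, roundMetric_timeField]
  simp only [timeField]; ring

/-- The metric has no cross terms with `dr`, so `r ∂_r` is normal to the level sets of `r`. It
serves both as radial momentum along geodesics and as the normal of the final hypersurface. -/
theorem metric_scalingField (M a : ℝ) (hp : 0 < radius p) : metric M a p v (scalingField p) =
    rhoSq a p / Delta M a p * (radius p * dr p v) := by
  simp only [metric_eq, dr_scalingField hp, sinSqDphi_scalingField, roundMetric_scalingField hp]
  simp only [scalingField_apply]; ring

/-- The quotient is `sin² ϑ`, so this is `cos² ϑ + sin² ϑ = 1`. -/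
theorem rhoSq_axial (a : ℝ) (hp : 0 < radius p) :
    rhoSq a p + a ^ 2 * ((p.2 0 ^ 2 + p.2 1 ^ 2) / radius p ^ 2) = radius p ^ 2 + a ^ 2 := by
  have := radius_sq p
  rw [rhoSq, cosTheta]
  field_simp
  linear_combination -a ^ 2 * this

theorem metric_axialField (M a : ℝ) (hp : 0 < radius p) : metric M a p v (axialField p) =
    (radius p ^ 2 + a ^ 2) * sinSqDphi p v - 2 * M * radius p / rhoSq a p * a
      * ((p.2 0 ^ 2 + p.2 1 ^ 2) / radius p ^ 2) * (v.1 - a * sinSqDphi p v) := by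
  rw [← rhoSq_axial a hp]
  simp only [metric_eq, dr_axialField, sinSqDphi_axialField, roundMetric_axialField]
  simp only [axialField_apply]; ring

/-- Scaling of the space coordinates. -/
def scale (l : ℝ) (p : Spacetime) : Spacetime := (p.1, l • p.2)

theorem hasDerivAt_scale (p : Spacetime) (l : ℝ) :
    HasDerivAt (fun l => scale l p) (scalingField p) l := by
  have h : HasDerivAt (fun l : ℝ => l • p.2) p.2 l := by
    simpa using (hasDerivAt_id l).smul_const p.2
  exact (hasDerivAt_const l p.1).prodMk h

theorem radius_scale {l : ℝ} (hl : 0 < l) : radius (scale l p) = l * radius p := by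
  simp [radius, scale, norm_smul, abs_of_pos hl]

theorem cosTheta_scale {l : ℝ} (hl : 0 < l) : cosTheta (scale l p) = cosTheta p := by
  rw [cosTheta, radius_scale hl, cosTheta]; simp only [scale, PiLp.smul_apply, smul_eq_mul]
  rw [mul_div_mul_left _ _ hl.ne']

theorem dr_scale {l : ℝ} (hl : 0 < l) : dr (scale l p) (scale l v) = l * dr p v := by
  rw [dr, radius_scale hl, dr]
  simp only [scale, real_inner_smul_left, inner_smul_right]
  rw [mul_div_mul_left _ _ hl.ne', mul_div_assoc]

theorem sinSqDphi_scale {l : ℝ} (hl : 0 < l) :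
    sinSqDphi (scale l p) (scale l v) = sinSqDphi p v := by
  rw [sinSqDphi, radius_scale hl, sinSqDphi]
  simp only [scale, PiLp.smul_apply, smul_eq_mul]
  rw [mul_pow, ← mul_div_mul_left _ (radius p ^ 2) (pow_ne_zero 2 hl.ne')]
  ring_nf

theorem roundMetric_scale {l : ℝ} (hl : 0 < l) :
    roundMetric (scale l p) (scale l v) (scale l w) = roundMetric p v w := by
  rw [roundMetric, radius_scale hl, dr_scale hl, dr_scale hl, roundMetric]
  simp only [scale, real_inner_smul_left, inner_smul_right]
  rw [mul_pow, ← mul_div_mul_left _ (radius p ^ 2) (pow_ne_zero 2 hl.ne')]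
  ring_nf

/-- The Lie derivative of the Kerr metric along `r ∂_r`. -/
def lieScaling (M a : ℝ) (p v w : Spacetime) : ℝ :=
  2 * M * radius p * (rhoSq a p - 2 * radius p ^ 2) / rhoSq a p ^ 2
      * ((v.1 - a * sinSqDphi p v) * (w.1 - a * sinSqDphi p w))
    + 2 * radius p ^ 2 * roundMetric p v w
    + (2 * (radius p ^ 2 + rhoSq a p) * Delta M a p
        - rhoSq a p * (2 * radius p ^ 2 - 2 * M * radius p)) / Delta M a p ^ 2
      * (dr p v * dr p w)

/-- For a linear vector field the flow is linear, and the left side is the derivative at the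
identity of the metric pulled back by that flow. -/
theorem fderiv_metric_scalingField {M : ℝ} {a : ℝ} (haM : |a| < M) (hp : p ∈ DOC M a)
    (v w : Spacetime) :
    fderiv ℝ (metricCLM M a) p (scalingField p) v w + metricCLM M a p (scalingField v) w
      + metricCLM M a p v (scalingField w) = lieScaling M a p v w := by
  have hr := radius_pos haM hp
  have hρ := rhoSq_pos (a := a) hr
  have hΔ := Delta_pos haM hp
  have e : ∀ q : Spacetime, scale 1 q = q := fun q => by simp [scale]
  have h := hasDerivAt_bilin (G := metricCLM M a) (x := fun l => scale l p)
    (v := fun l => scale l v) (w := fun l => scale l w) (s := 1)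
    (by rw [e]; exact differentiableAt_metricCLM haM hp)
    (hasDerivAt_scale p 1) (hasDerivAt_scale v 1) (hasDerivAt_scale w 1)
  simp only [e] at h
  refine h.unique ?_
  set r := radius p with hrdef
  set c := cosTheta p with hc
  -- Scaling leaves `ϑ`, `sin² ϑ dφ` and the round metric unchanged and multiplies `r` and `dr` by
  -- `l`, so only explicit rational functions of `l` remain to be differentiated.
  have hev : (fun l => metricCLM M a (scale l p) (scale l v) (scale l w)) =ᶠ[nhds 1] fun l =>
      -(v.1 * w.1) + 2 * M * (l * r) / ((l * r) ^ 2 + a ^ 2 * c ^ 2)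
          * ((v.1 - a * sinSqDphi p v) * (w.1 - a * sinSqDphi p w))
        + a ^ 2 * (sinSqDphi p v * sinSqDphi p w)
        + ((l * r) ^ 2 + a ^ 2 * c ^ 2) * roundMetric p v w
        + ((l * r) ^ 2 + a ^ 2 * c ^ 2) / ((l * r) ^ 2 - 2 * M * (l * r) + a ^ 2)
          * ((l * dr p v) * (l * dr p w)) := by
    filter_upwards [lt_mem_nhds (zero_lt_one (α := ℝ))] with l hl
    rw [metricCLM_apply, metric_eq, rhoSq, Delta, cosTheta_scale hl, radius_scale hl, dr_scale hl,
      dr_scale hl, sinSqDphi_scale hl, sinSqDphi_scale hl, roundMetric_scale hl]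
    rfl
  refine HasDerivAt.congr_of_eventuallyEq ?_ hev
  have e1 : rhoSq a p = r ^ 2 + a ^ 2 * c ^ 2 := rfl
  have e2 : Delta M a p = r ^ 2 - 2 * M * r + a ^ 2 := rfl
  have hl : HasDerivAt (fun l : ℝ => l * r) r 1 := by
    simpa using (hasDerivAt_id (1 : ℝ)).mul_const r
  have h1 : HasDerivAt (fun l : ℝ => (l * r) ^ 2 + a ^ 2 * c ^ 2) (2 * r ^ 2) 1 := by
    have := (hl.fun_pow 2).add_const (a ^ 2 * c ^ 2)
    refine this.congr_deriv ?_; push_cast; ring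
  have h2 : HasDerivAt (fun l : ℝ => (l * r) ^ 2 - 2 * M * (l * r) + a ^ 2)
      (2 * r ^ 2 - 2 * M * r) 1 := by
    have := ((hl.fun_pow 2).fun_sub (hl.const_mul (2 * M))).add_const (a ^ 2)
    refine this.congr_deriv ?_; push_cast; ring
  have h3 : ∀ x : ℝ, HasDerivAt (fun l : ℝ => l * x) x 1 := fun x => by
    simpa using (hasDerivAt_id (1 : ℝ)).mul_const x
  have hne1 : (1 * r) ^ 2 + a ^ 2 * c ^ 2 ≠ 0 := by rw [one_mul, ← e1]; exact hρ.ne'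
  have hne2 : (1 * r) ^ 2 - 2 * M * (1 * r) + a ^ 2 ≠ 0 := by
    rw [one_mul, ← e2]; exact hΔ.ne'
  have key := ((((((hl.const_mul (2 * M)).fun_div h1 hne1).mul_const
    ((v.1 - a * sinSqDphi p v) * (w.1 - a * sinSqDphi p w))).const_add (-(v.1 * w.1))).add_const
    (a ^ 2 * (sinSqDphi p v * sinSqDphi p w))).fun_add (h1.mul_const (roundMetric p v w))).fun_add
    ((h1.fun_div h2 hne2).fun_mul ((h3 (dr p v)).fun_mul (h3 (dr p w))))
  refine key.congr_deriv ?_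
  simp only [one_mul, ← e1, ← e2, lieScaling, ← hrdef]
  have := hρ.ne'
  have := hΔ.ne'
  field_simp
  ring

/-- Rotation about the axis. -/
def rotate (τ : ℝ) (p : Spacetime) : Spacetime :=
  (p.1, !₂[Real.cos τ * p.2 0 - Real.sin τ * p.2 1, Real.sin τ * p.2 0 + Real.cos τ * p.2 1, p.2 2])

theorem hasDerivAt_rotate (p : Spacetime) :
    HasDerivAt (fun τ => rotate τ p) (axialField p) 0 := by
  refine (hasDerivAt_const (0 : ℝ) p.1).prodMk ?_
  rw [← hasDerivWithinAt_univ, hasDerivWithinAt_iff_hasFDerivWithinAt,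
    hasFDerivWithinAt_euclidean]
  intro i
  rw [hasFDerivWithinAt_univ, hasFDerivAt_iff_hasDerivAt]
  have hc := Real.hasDerivAt_cos 0
  have hs := Real.hasDerivAt_sin 0
  fin_cases i
  · simpa using (hc.mul_const (p.2 0)).fun_sub (hs.mul_const (p.2 1))
  · simpa using (hs.mul_const (p.2 0)).fun_add (hc.mul_const (p.2 1))
  · simpa using hasDerivAt_const (0 : ℝ) (p.2 2)

theorem inner_rotate (τ : ℝ) (p v : Spacetime) :
    inner ℝ (rotate τ p).2 (rotate τ v).2 = (inner ℝ p.2 v.2 : ℝ) := by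
  simp [inner_eq, rotate]
  linear_combination (p.2 0 * v.2 0 + p.2 1 * v.2 1) * Real.sin_sq_add_cos_sq τ

theorem radius_rotate (τ : ℝ) (p : Spacetime) : radius (rotate τ p) = radius p := by
  have := inner_rotate τ p p
  rw [real_inner_self_eq_norm_sq, real_inner_self_eq_norm_sq] at this
  exact (sq_eq_sq₀ (norm_nonneg _) (norm_nonneg _)).1 this

theorem sinSqDphi_rotate (τ : ℝ) (p v : Spacetime) :
    sinSqDphi (rotate τ p) (rotate τ v) = sinSqDphi p v := by
  rw [sinSqDphi, radius_rotate, sinSqDphi]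
  congr 1
  simp [rotate]
  linear_combination (p.2 0 * v.2 1 - p.2 1 * v.2 0) * Real.sin_sq_add_cos_sq τ

theorem metric_rotate (M a τ : ℝ) (p v w : Spacetime) :
    metric M a (rotate τ p) (rotate τ v) (rotate τ w) = metric M a p v w := by
  simp only [metric, sinSqDphi_rotate, roundMetric, dr, inner_rotate, rhoSq, Delta, cosTheta,
    radius_rotate]
  simp [rotate]

/-- Killing equation of `∂_φ`: rotations are isometries, so the pulled back metric is constant along
the flow. -/
theorem fderiv_metric_axialField {M a : ℝ} (haM : |a| < M) (hp : p ∈ DOC M a)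
    (v w : Spacetime) :
    fderiv ℝ (metricCLM M a) p (axialField p) v w + metricCLM M a p (axialField v) w
      + metricCLM M a p v (axialField w) = 0 := by
  have e : ∀ q : Spacetime, rotate 0 q = q := fun q => by
    ext i
    · simp [rotate]
    · fin_cases i <;> simp [rotate]
  have h := hasDerivAt_bilin (G := metricCLM M a) (x := fun l => rotate l p)
    (v := fun l => rotate l v) (w := fun l => rotate l w) (s := 0)
    (by rw [e]; exact differentiableAt_metricCLM haM hp)
    (hasDerivAt_rotate p) (hasDerivAt_rotate v) (hasDerivAt_rotate w)
  simp only [e, metricCLM_apply, metric_rotate] at h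
  exact h.unique (hasDerivAt_const _ _)

theorem fderiv_metric_timeField {M a : ℝ} (haM : |a| < M) (hp : p ∈ DOC M a)
    (v w : Spacetime) : fderiv ℝ (metricCLM M a) p timeField v w = 0 := by
  have hx : HasDerivAt (fun τ : ℝ => ((p.1 + τ, p.2) : Spacetime)) timeField 0 :=
    ((hasDerivAt_id (0 : ℝ)).const_add p.1).prodMk (hasDerivAt_const 0 p.2)
  have h := hasDerivAt_bilin (G := metricCLM M a) (x := fun τ : ℝ => (p.1 + τ, p.2))
    (v := fun _ => v) (w := fun _ => w) (s := 0)
    (by simpa using differentiableAt_metricCLM haM hp)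
    hx (hasDerivAt_const _ _) (hasDerivAt_const _ _)
  simp only [add_zero, map_zero, _root_.zero_apply] at h
  exact h.unique (hasDerivAt_const (0 : ℝ) (metric M a p v w))

end Fields

/-! ### Bounded null geodesics of the Kerr spacetime -/

/-- A bounded solution, on the whole line, of a first order system repelled from `c`: auxiliary
one-sided estimate. -/
theorem repelled_mul_nonpos {r W α β : ℝ → ℝ} {c m C : ℝ} (hm : 0 < m) (hα : ∀ s, m ≤ α s)
    (hr : ∀ s, HasDerivAt r (α s * W s) s) (hW : ∀ s, HasDerivAt W (β s) s)
    (hβ : ∀ s, 0 ≤ (r s - c) * β s) (hC : ∀ s, (r s - c) ^ 2 ≤ C) (s : ℝ) :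
    (r s - c) * W s ≤ 0 := by
  by_contra! hpos
  have hY : ∀ s, HasDerivAt (fun s => (r s - c) * W s)
      (α s * W s * W s + (r s - c) * β s) s := fun s => ((hr s).sub_const c).fun_mul (hW s)
  have hmono : Monotone fun s => (r s - c) * W s :=
    monotone_of_hasDerivAt_nonneg hY fun s => by
      have := hβ s
      have h1 := hm.trans_le (hα s)
      have : 0 ≤ α s * (W s * W s) := mul_nonneg h1.le (mul_self_nonneg _)
      simp only [Pi.zero_apply]
      linarith
  have hz : ∀ t, HasDerivAt (fun s => (r s - c) ^ 2) (2 * α t * ((r t - c) * W t)) t := fun t =>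
    (((hr t).sub_const c).fun_pow 2).congr_deriv (by push_cast; ring)
  set y := (r s - c) * W s with hy
  -- The product `(r - c) W` is nondecreasing; if it equals `y > 0` at time `s`, then `(r - c)²`
  -- grows afterwards at rate at least `2 m y`.
  have key := (convex_Ici s).mul_sub_le_image_sub_of_le_deriv (f := fun s => (r s - c) ^ 2)
    (C := 2 * m * y)
    (fun t _ => (hz t).continuousAt.continuousWithinAt)
    (fun t _ => (hz t).differentiableAt.differentiableWithinAt)
    (fun t ht => by
      rw [interior_Ici] at ht
      rw [(hz t).deriv]
      have h1 : y ≤ (r t - c) * W t := hmono (le_of_lt ht)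
      have h2 := hα t
      exact mul_le_mul (by linarith) h1 hpos.le (by linarith))
  have hC0 : 0 ≤ C := (sq_nonneg _).trans (hC s)
  -- The waiting time after which the growth reaches `C + 1`, beyond the bound `C`.
  have h1 := key s (Set.self_mem_Ici) (s + (C + 1) / (2 * m * y))
    (by simp only [Set.mem_Ici, le_add_iff_nonneg_right]; positivity)
    (by simp only [le_add_iff_nonneg_right]; positivity)
  have h2 : 2 * m * y * (s + (C + 1) / (2 * m * y) - s) = C + 1 := by
    field_simp; ring
  rw [h2] at h1
  have h3 := hC (s + (C + 1) / (2 * m * y))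
  have h4 := sq_nonneg (r s - c)
  linarith

/-- A bounded solution, on the whole line, of a first order system repelled from `c` is
stationary. -/
theorem repelled_eq_zero {r W α β : ℝ → ℝ} {c m C : ℝ} (hm : 0 < m) (hα : ∀ s, m ≤ α s)
    (hr : ∀ s, HasDerivAt r (α s * W s) s) (hW : ∀ s, HasDerivAt W (β s) s)
    (hβ : ∀ s, 0 ≤ (r s - c) * β s) (hC : ∀ s, (r s - c) ^ 2 ≤ C) (s : ℝ) : W s = 0 := by
  have h1 := repelled_mul_nonpos hm hα hr hW hβ hC
  -- The system is invariant under reversal of time with `W` changing sign, so `(r - c) W` is also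
  -- nonnegative.
  have h2 := repelled_mul_nonpos (r := fun s => r (-s)) (W := fun s => -W (-s))
    (α := fun s => α (-s)) (β := fun s => β (-s)) hm (fun s => hα _)
    (fun s => by
      have := (hr (-s)).scomp s (hasDerivAt_neg s)
      exact this.congr_deriv (by simp))
    (fun s => by
      have := ((hW (-s)).scomp s (hasDerivAt_neg s)).fun_neg
      exact this.congr_deriv (by simp))
    (fun s => hβ _) (fun s => hC _)
  have h0 : ∀ s, (r s - c) * W s = 0 := fun s => by
    have := h2 (-s)
    simp only [neg_neg] at this
    linarith [h1 s]
  -- Once `(r - c) W` vanishes identically, so does its derivative, a sum of two nonnegative terms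
  -- one of which is `α W²`.
  have hY : HasDerivAt (fun s => (r s - c) * W s)
      (α s * W s * W s + (r s - c) * β s) s := ((hr s).sub_const c).fun_mul (hW s)
  have hz : HasDerivAt (fun s => (r s - c) * W s) 0 s := by
    simp only [h0]; exact hasDerivAt_const _ _
  have h3 := hY.unique hz
  have h4 := hβ s
  have h5 : 0 ≤ W s * W s := mul_self_nonneg _
  have h6 := hm.trans_le (hα s)
  have h7 : α s * (W s * W s) ≤ 0 := by linarith
  have h8 : W s * W s ≤ 0 := nonpos_of_mul_nonpos_right h7 h6
  exact mul_self_eq_zero.1 (le_antisymm h8 h5)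

/-! ### Sign analysis of the radial force. -/

/-- The function `P = (r² + a²) E - a L` in the radial equation of geodesics. -/
def radialP (a E L r : ℝ) : ℝ := (r ^ 2 + a ^ 2) * E - a * L

/-- Half of `2 P' Δ - P Δ'`, with `P = radialP a E L`. -/
def radialG (M a E L r : ℝ) : ℝ :=
  2 * r * E * (r ^ 2 - 2 * M * r + a ^ 2) - (r - M) * radialP a E L r

/-- The function `E G/(r - M)` is nondecreasing for `r > M`; `id` below is the difference of its
values at `t` and `r`, cleared of denominators. Hence `E G` can only pass from nonpositive to
positive as the radius increases. -/
theorem radialG_nonpos_of_le {M a E L r t : ℝ} (haM : |a| < M) (hr : M < r) (hrt : r ≤ t)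
    (ht : E * radialG M a E L t ≤ 0) : E * radialG M a E L r ≤ 0 := by
  have hb := sq_lt_sq_of_abs_lt haM
  have hM := mass_pos haM
  have hu : 0 < r - M := by linarith
  have hw : 0 < t - M := by linarith
  have id : (r - M) * (E * radialG M a E L t) - (t - M) * (E * radialG M a E L r)
      = E ^ 2 * ((t - r) * ((r - M) * (t - M) * ((t - M) + (r - M))
        + 2 * M * (M ^ 2 - a ^ 2))) := by
    simp only [radialG, radialP]; ring
  have h1 : 0 ≤ E ^ 2 * ((t - r) * ((r - M) * (t - M) * ((t - M) + (r - M))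
        + 2 * M * (M ^ 2 - a ^ 2))) := by
    have : 0 ≤ t - r := by linarith
    positivity
  have h2 := mul_nonneg hu.le (neg_nonneg.2 ht)
  have h3 : (t - M) * (E * radialG M a E L r) ≤ 0 := by linarith
  exact nonpos_of_mul_nonpos_right h3 hw

/-- The radial motion is repelled from some radius. -/
theorem exists_repelling_radius {M a E L r₁ r₂ : ℝ} (haM : |a| < M)
    (hr₁ : horizonRadius M a < r₁) {r : ℝ → ℝ} (hr : ∀ s, r₁ ≤ r s ∧ r s ≤ r₂)
    (hcont : Continuous r) (hP : ∀ s, radialP a E L (r s) ≠ 0) :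
    ∃ c, ∀ s, 0 ≤ (r s - c) * (radialP a E L (r s) * radialG M a E L (r s)) := by
  have hM := mass_pos haM
  have hMr₁ := mass_lt_of_horizonRadius_lt haM hr₁
  -- If `E P ≤ 0` throughout, both terms of `P G = 2rΔ(E P) - (r - M)P²` are nonpositive, so the
  -- force is inward and any upper bound of the radius serves as `c`.
  by_cases hneg : ∀ s, E * radialP a E L (r s) ≤ 0
  · refine ⟨r₂, fun s => ?_⟩
    have h1 : r s - r₂ ≤ 0 := by linarith [hr s]
    refine mul_nonneg_of_nonpos_of_nonpos h1 ?_
    have hΔ := Delta_pos_of_horizonRadius_lt haM (hr₁.trans_le (hr s).1)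
    have e : radialP a E L (r s) * radialG M a E L (r s)
        = 2 * r s * (r s ^ 2 - 2 * M * r s + a ^ 2) * (E * radialP a E L (r s))
          - (r s - M) * radialP a E L (r s) ^ 2 := by
      rw [radialG]; ring
    have h2 : 0 < r s - M := by linarith [hr s]
    have h3 : 0 < r s := by linarith
    have h4 : 0 ≤ 2 * r s * (r s ^ 2 - 2 * M * r s + a ^ 2) * -(E * radialP a E L (r s)) :=
      mul_nonneg (by positivity) (by linarith [hneg s])
    have h5 : 0 ≤ (r s - M) * radialP a E L (r s) ^ 2 := by positivity
    rw [e]; linarith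
  · push Not at hneg
    obtain ⟨s₀, hs₀⟩ := hneg
    have hE : E ≠ 0 := by rintro rfl; simp at hs₀
    -- Since `P` has no zero along the motion, the intermediate value theorem fixes the sign of `E
    -- P`.
    have hpos : ∀ s, 0 < E * radialP a E L (r s) := by
      intro s
      by_contra! hs
      have hc : Continuous fun s => E * radialP a E L (r s) := by unfold radialP; fun_prop
      obtain ⟨t, ht⟩ := mem_range_of_exists_le_of_exists_ge hc ⟨s, hs⟩ ⟨s₀, hs₀.le⟩
      exact mul_ne_zero hE (hP t) ht
    -- The repelling radius is the point where `E G` changes sign. Inserting `r₁` gives `c = r₁`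
    -- when `E G` is positive on the whole range.
    set T : Set ℝ := insert r₁ {t | (r₁ ≤ t ∧ t ≤ r₂) ∧ E * radialG M a E L t ≤ 0} with hT
    have hTb : BddAbove T := ⟨max r₁ r₂, by
      rintro t (rfl | ht)
      · exact le_max_left _ _
      · exact ht.1.2.trans (le_max_right _ _)⟩
    refine ⟨sSup T, fun s => ?_⟩
    have key : 0 ≤ (r s - sSup T) * (E * radialG M a E L (r s)) := by
      rcases le_total (r s) (sSup T) with h | h
      · rcases h.eq_or_lt with h | h
        · rw [h]; simp
        · obtain ⟨t, ht, hst⟩ := exists_lt_of_lt_csSup ⟨r₁, Set.mem_insert _ _⟩ h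
          refine mul_nonneg_of_nonpos_of_nonpos (by linarith) ?_
          rcases ht with rfl | ht
          · linarith [hr s]
          · exact radialG_nonpos_of_le haM (hMr₁.trans_le (hr s).1) hst.le ht.2
      · rcases le_or_gt (E * radialG M a E L (r s)) 0 with h0 | h0
        · have : r s ≤ sSup T := le_csSup hTb (Or.inr ⟨hr s, h0⟩)
          rw [le_antisymm this h]; simp
        · exact mul_nonneg (by linarith) h0.le
    have h2 := mul_nonneg key (hpos s).le
    have e : (r s - sSup T) * (E * radialG M a E L (r s)) * (E * radialP a E L (r s))
      = E ^ 2 * ((r s - sSup T) * (radialP a E L (r s) * radialG M a E L (r s))) := by ring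
    rw [e] at h2
    exact nonneg_of_mul_nonneg_right h2 (by positivity)

/-- The geodesic operator `n ↦ g(∇_{x'} x', n)` of a curve `x`. -/
def accel (M a : ℝ) (x : ℝ → Spacetime) (s : ℝ) (n : Spacetime) : ℝ :=
  metric M a (x s) (deriv (deriv x) s) n
    + christoffelFirst (metric M a) (x s) (deriv x s) (deriv x s) n

/-! ### Conservation laws and the radial equation along null geodesics. -/

section Curves

variable {M a : ℝ} {x : ℝ → Spacetime} {s : ℝ}

theorem hasDerivAt_metric_velocity (haM : |a| < M) (hs : x s ∈ DOC M a)
    (hx : DifferentiableAt ℝ x s) (hx' : DifferentiableAt ℝ (deriv x) s) {Z : ℝ → Spacetime}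
    {Z' : Spacetime} (hZ : HasDerivAt Z Z' s) :
    HasDerivAt (fun s => metric M a (x s) (deriv x s) (Z s))
      (accel M a x s (Z s) + fderiv ℝ (metricCLM M a) (x s) (Z s) (deriv x s) (deriv x s) / 2
        + metric M a (x s) (deriv x s) Z') s := by
  have h := hasDerivAt_bilin (differentiableAt_metricCLM haM hs) hx.hasDerivAt hx'.hasDerivAt hZ
  have e := christoffelFirst_eq (g := metric M a) (G := metricCLM M a) (fun _ _ _ => rfl)
    (differentiableAt_metricCLM haM hs) (deriv x s) (deriv x s) (Z s)
  simp only [metricCLM_apply] at h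
  refine h.congr_deriv ?_
  rw [accel, e]
  ring

/-- The parenthesis is the Lie derivative of the metric along the linear field `B`, evaluated on the
velocity. It vanishes for `∂_φ`, which gives conservation of `L`; for `r ∂_r` it governs the radial
momentum. -/
theorem hasDerivAt_metric_velocity_field (haM : |a| < M) (hs : x s ∈ DOC M a)
    (hx : DifferentiableAt ℝ x s) (hx' : DifferentiableAt ℝ (deriv x) s)
    (B : Spacetime →L[ℝ] Spacetime) :
    HasDerivAt (fun s => metric M a (x s) (deriv x s) (B (x s)))
      (accel M a x s (B (x s)) + (fderiv ℝ (metricCLM M a) (x s) (B (x s)) (deriv x s) (deriv x s)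
        + metricCLM M a (x s) (B (deriv x s)) (deriv x s)
        + metricCLM M a (x s) (deriv x s) (B (deriv x s))) / 2) s := by
  refine (hasDerivAt_metric_velocity haM hs hx hx'
    (B.hasFDerivAt.comp_hasDerivAt s hx.hasDerivAt)).congr_deriv ?_
  rw [metricCLM_comm M a (x s) (B (deriv x s)), metricCLM_apply]
  simp only [Function.comp_apply]
  ring

theorem hasDerivAt_radius (hs : 0 < radius (x s)) (hx : DifferentiableAt ℝ x s) :
    HasDerivAt (fun s => radius (x s)) (dr (x s) (deriv x s)) s := by
  have h1 : HasDerivAt (fun s => (x s).2) (deriv x s).2 s :=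
    (ContinuousLinearMap.snd ℝ ℝ (EuclideanSpace ℝ (Fin 3))).hasFDerivAt.comp_hasDerivAt s
      hx.hasDerivAt
  have h2 := (h1.norm_sq).sqrt (pow_ne_zero 2 hs.ne')
  have e : (fun s => √(‖(x s).2‖ ^ 2)) = fun s => radius (x s) := by
    funext s; exact Real.sqrt_sq (norm_nonneg _)
  rw [e] at h2
  refine h2.congr_deriv ?_
  rw [Real.sqrt_sq (norm_nonneg _), dr, radius]
  have : ‖(x s).2‖ ≠ 0 := hs.ne'
  field_simp

theorem roundMetric_nonneg {p : Spacetime} (hp : 0 < radius p) (v : Spacetime) :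
    0 ≤ roundMetric p v v := by
  rw [roundMetric, dr]
  refine div_nonneg ?_ (sq_nonneg _)
  have h := real_inner_mul_inner_self_le p.2 v.2
  have e : inner ℝ p.2 p.2 = radius p ^ 2 := real_inner_self_eq_norm_sq _
  rw [e] at h
  have : inner ℝ p.2 v.2 / radius p * (inner ℝ p.2 v.2 / radius p) ≤ inner ℝ v.2 v.2 := by
    rw [div_mul_div_comm, div_le_iff₀ (by positivity)]
    linarith
  linarith

/-- A null vector annihilated by `dt - a sin² ϑ dφ` vanishes. -/
theorem eq_zero_of_null (haM : |a| < M) {p v : Spacetime} (hp : p ∈ DOC M a)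
    (hnull : metric M a p v v = 0) (hq : v.1 - a * sinSqDphi p v = 0) : v = 0 := by
  have hr := radius_pos haM hp
  have hρ := rhoSq_pos (a := a) hr
  have hΔ := Delta_pos haM hp
  have hB := roundMetric_nonneg hr v
  -- When `dt = a sin² ϑ dφ`, the terms `-dt²` and `a² (sin² ϑ dφ)²` cancel and a sum of nonnegative
  -- terms remains.
  have h1 : rhoSq a p * roundMetric p v v + rhoSq a p / Delta M a p * (dr p v * dr p v) = 0 := by
    rw [metric_eq, hq] at hnull
    have : v.1 = a * sinSqDphi p v := by linarith
    rw [this] at hnull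
    linarith
  have h2 : 0 ≤ rhoSq a p * roundMetric p v v := by positivity
  have h3 : 0 ≤ rhoSq a p / Delta M a p * (dr p v * dr p v) :=
    mul_nonneg (by positivity) (mul_self_nonneg _)
  have h4 : dr p v = 0 := by
    have : rhoSq a p / Delta M a p * (dr p v * dr p v) = 0 := by linarith
    simpa [hρ.ne', hΔ.ne'] using this
  have h5 : roundMetric p v v = 0 := by
    have : rhoSq a p * roundMetric p v v = 0 := by linarith
    simpa [hρ.ne'] using this
  have h6 : v.2 = 0 := by
    rw [roundMetric, h4] at h5
    simpa [hr.ne'] using h5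
  have h7 : sinSqDphi p v = 0 := by simp [sinSqDphi, h6]
  rw [h7] at hq
  exact Prod.ext (by simpa using hq) h6

/-- The radial equation, as an identity for null vectors. -/
theorem radial_identity {M a r ρ Δ τ σ B d S k : ℝ} (hr : r ≠ 0) (hρ : ρ ≠ 0)
    (hΔ0 : Δ ≠ 0) (hΔ : Δ = r ^ 2 - 2 * M * r + a ^ 2) (hS : ρ + a ^ 2 * S = r ^ 2 + a ^ 2)
    (hk : k = 2 * M * r / ρ)
    (hnull : -(τ * τ) + k * ((τ - a * σ) * (τ - a * σ)) + a ^ 2 * (σ * σ) + ρ * B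
      + ρ / Δ * (d * d) = 0) {E L : ℝ} (hE : E = τ - k * (τ - a * σ))
    (hL : L = (r ^ 2 + a ^ 2) * σ - k * a * S * (τ - a * σ)) :
    radialP a E L r = Δ * (τ - a * σ) ∧
    (r - M) * d * (ρ * d / Δ)
      + Δ * ((2 * M * r * (ρ - 2 * r ^ 2) / ρ ^ 2 * ((τ - a * σ) * (τ - a * σ))
        + 2 * r ^ 2 * B + (2 * (r ^ 2 + ρ) * Δ - ρ * (2 * r ^ 2 - 2 * M * r)) / Δ ^ 2 * (d * d))
          / (2 * r) - ρ * d / Δ * d / r)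
      = radialP a E L r * radialG M a E L r / (Δ * ρ) := by
  have hkρ : k * ρ = 2 * M * r := by rw [hk]; field_simp
  -- This factorization shows that `P` vanishes only where `dt - a sin² ϑ dφ` annihilates the
  -- velocity, which is impossible for a nonzero null vector.
  have hP : radialP a E L r = Δ * (τ - a * σ) := by
    rw [radialP, hE, hL, hΔ]
    linear_combination -(k * (τ - a * σ)) * (-hS) - (τ - a * σ) * hkρ
  refine ⟨hP, ?_⟩
  -- The null condition eliminates the angular kinetic term; the force then depends only on `r`, `E`
  -- and `L`, up to the positive factor `1/(Δρ²)`.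
  have hB : B = (τ * τ - k * ((τ - a * σ) * (τ - a * σ)) - a ^ 2 * (σ * σ)
      - ρ / Δ * (d * d)) / ρ := by
    rw [eq_div_iff hρ]; linarith
  have hG : radialG M a E L r = Δ * (2 * r * E - (r - M) * (τ - a * σ)) := by
    rw [radialG, hP, ← hΔ]; ring
  rw [hP, hG, hB, hE, hk]
  field_simp
  ring

/-- A complete null geodesic of the Kerr spacetime that stays in a compact range of radii has
constant radius. -/
theorem dr_velocity_eq_zero (haM : |a| < M) {r₁ r₂ : ℝ} (hr₁ : horizonRadius M a < r₁)
    (hx : ContDiff ℝ 2 x) (hb : ∀ s, r₁ ≤ radius (x s) ∧ radius (x s) ≤ r₂)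
    (hacc : ∀ s n, accel M a x s n = 0) (hne : ∀ s, deriv x s ≠ 0)
    (hnull : ∀ s, metric M a (x s) (deriv x s) (deriv x s) = 0) (s : ℝ) :
    dr (x s) (deriv x s) = 0 := by
  have hD : ∀ s, x s ∈ DOC M a := fun s => hr₁.trans_le (hb s).1
  have hd : Differentiable ℝ x := hx.differentiable (by simp)
  have hd' : Differentiable ℝ (deriv x) := by
    have : ContDiff ℝ 1 (deriv x) := by
      have h : ContDiff ℝ (1 + 1) x := by simpa [one_add_one_eq_two] using hx
      exact (contDiff_succ_iff_deriv.1 h).2.2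
    exact this.differentiable (by simp)
  have hrpos : ∀ s, 0 < radius (x s) := fun s => radius_pos haM (hD s)
  have hρ : ∀ s, 0 < rhoSq a (x s) := fun s => rhoSq_pos (hrpos s)
  have hΔ : ∀ s, 0 < Delta M a (x s) := fun s => Delta_pos haM (hD s)
  -- Energy and axial angular momentum are conserved because `∂_t` and `∂_φ` are Killing fields.
  obtain ⟨E, hE⟩ : ∃ E, ∀ s, metric M a (x s) (deriv x s) timeField = -E := by
    refine ⟨-metric M a (x 0) (deriv x 0) timeField, fun s => ?_⟩
    rw [neg_neg]
    refine is_const_of_deriv_eq_zero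
      (f := fun s => metric M a (x s) (deriv x s) timeField) (fun s => ?_) (fun s => ?_) s 0
    · exact (hasDerivAt_metric_velocity haM (hD s) (hd s) (hd' s)
        (hasDerivAt_const s timeField)).differentiableAt
    · rw [(hasDerivAt_metric_velocity haM (hD s) (hd s) (hd' s)
        (hasDerivAt_const s timeField)).deriv, hacc, fderiv_metric_timeField haM (hD s),
        ← metricCLM_apply]
      simp
  obtain ⟨L, hL⟩ : ∃ L, ∀ s, metric M a (x s) (deriv x s) (axialField (x s)) = L := by
    refine ⟨metric M a (x 0) (deriv x 0) (axialField (x 0)), fun s => ?_⟩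
    have h := fun s => hasDerivAt_metric_velocity_field haM (hD s) (hd s) (hd' s) axialField
    refine is_const_of_deriv_eq_zero
      (f := fun s => metric M a (x s) (deriv x s) (axialField (x s)))
      (fun s => (h s).differentiableAt) (fun s => ?_) s 0
    rw [(h s).deriv, hacc, fderiv_metric_axialField haM (hD s)]
    simp
  have hscal := fun s => hasDerivAt_metric_velocity_field haM (hD s) (hd s) (hd' s) scalingField
  simp only [hacc, fderiv_metric_scalingField haM (hD _), zero_add] at hscal
  have hrad := fun s => hasDerivAt_radius (hrpos s) (hd s)
  have hid := fun s => radial_identity (M := M) (a := a) (r := radius (x s)) (ρ := rhoSq a (x s))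
    (Δ := Delta M a (x s)) (τ := (deriv x s).1) (σ := sinSqDphi (x s) (deriv x s))
    (B := roundMetric (x s) (deriv x s) (deriv x s)) (d := dr (x s) (deriv x s)) (E := E) (L := L)
    (hrpos s).ne' (hρ s).ne' (hΔ s).ne' rfl (rhoSq_axial a (hrpos s)) rfl
    (by rw [← metric_eq]; exact hnull s)
    (by have := hE s; rw [metric_timeField] at this; linarith)
    (by rw [← hL s, metric_axialField M a (hrpos s)])
  have hcont : Continuous fun s => radius (x s) :=
    continuous_iff_continuousAt.2 fun s => (hrad s).continuousAt
  obtain ⟨c, hc⟩ := exists_repelling_radius (E := E) (L := L) haM hr₁ hb hcont fun s => by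
    rw [(hid s).1]
    refine mul_ne_zero (hΔ s).ne' fun h => hne s (eq_zero_of_null haM (hD s) (hnull s) h)
  have hsq : ∀ s, √(Delta M a (x s)) * √(Delta M a (x s)) = Delta M a (x s) := fun s =>
    Real.mul_self_sqrt (hΔ s).le
  have hsqpos : ∀ s, 0 < √(Delta M a (x s)) := fun s => Real.sqrt_pos.2 (hΔ s)
  have hMr := mass_lt_of_horizonRadius_lt haM hr₁
  have hM := mass_pos haM
  have hΔ₁ := Delta_pos_of_horizonRadius_lt haM hr₁
  -- Here `W = ρ² r'/√Δ`. The weight `√Δ` removes the `r'²` terms from `W'`. The bound `m` uses that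
  -- `Δ` increases for `r > M` and that `ρ² ≤ r² + a²`.
  have h := repelled_eq_zero (r := fun s => radius (x s))
    (W := fun s => √(Delta M a (x s)) * (metric M a (x s) (deriv x s) (scalingField (x s))
      / radius (x s)))
    (α := fun s => √(Delta M a (x s)) / rhoSq a (x s))
    (β := fun s => radialP a E L (radius (x s)) * radialG M a E L (radius (x s))
      / (Delta M a (x s) * rhoSq a (x s)) / √(Delta M a (x s)))
    (c := c) (m := √(r₁ ^ 2 - 2 * M * r₁ + a ^ 2) / (r₂ ^ 2 + a ^ 2))
    (C := (|r₁| + |r₂| + |c|) ^ 2) ?_ ?_ ?_ ?_ ?_ ?_ s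
  · rw [metric_scalingField M a (hrpos s)] at h
    simpa [(hsqpos s).ne', (hrpos s).ne', (hρ s).ne', (hΔ s).ne'] using h
  · have h1 := Real.sqrt_pos.2 hΔ₁
    have : 0 < r₂ := (hrpos s).trans_le (hb s).2
    positivity
  · intro s
    have hr := hb s
    have hr0 := hrpos s
    have h1 : rhoSq a (x s) ≤ r₂ ^ 2 + a ^ 2 := by
      have e := rhoSq_axial a (hrpos s)
      have : 0 ≤ a ^ 2 * (((x s).2 0 ^ 2 + (x s).2 1 ^ 2) / radius (x s) ^ 2) := by positivity
      nlinarith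
    refine div_le_div₀ (Real.sqrt_nonneg _) (Real.sqrt_le_sqrt ?_) (hρ s) h1
    rw [Delta]
    nlinarith
  · intro s
    refine (hrad s).congr_deriv ?_
    rw [metric_scalingField M a (hrpos s)]
    have h1 := (hρ s).ne'
    have h2 := (hrpos s).ne'
    have h3 := (hΔ s).ne'
    have e : √(Delta M a (x s)) / rhoSq a (x s) * (√(Delta M a (x s)) *
        (rhoSq a (x s) / Delta M a (x s) * (radius (x s) * dr (x s) (deriv x s)) / radius (x s)))
      = (√(Delta M a (x s)) * √(Delta M a (x s))) / rhoSq a (x s) *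
        (rhoSq a (x s) / Delta M a (x s) * (radius (x s) * dr (x s) (deriv x s)) / radius (x s)) := by
      ring
    rw [e, hsq]
    field_simp
  · intro s
    have hΔ' : HasDerivAt (fun s => Delta M a (x s))
        (2 * (radius (x s) - M) * dr (x s) (deriv x s)) s := by
      have := (((hrad s).fun_pow 2).fun_sub ((hrad s).const_mul (2 * M))).add_const (a ^ 2)
      exact this.congr_deriv (by push_cast; ring)
    refine ((hΔ'.sqrt (hΔ s).ne').fun_mul ((hscal s).fun_div (hrad s) (hrpos s).ne')).congr_deriv ?_
    -- The identity in `hid` is the formula for `√Δ W'`.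
    rw [eq_div_iff (hsqpos s).ne', ← (hid s).2, metric_scalingField M a (hrpos s), lieScaling]
    have h2 := (hrpos s).ne'
    have h4 := (hsqpos s).ne'
    have e : ∀ A B C R D : ℝ, R ≠ 0 → D ≠ 0 → (A / (2 * D) * B + D * C) * D
        = A / 2 * B + (D * D) * C := by
      intro A B C R D hR hD; field_simp
    rw [e _ _ _ _ _ h2 h4, hsq]
    have h3 := (hΔ s).ne'
    field_simp
  · intro s
    have h1 : 0 < 1 / (Delta M a (x s) * rhoSq a (x s)) / √(Delta M a (x s)) := by
      have := hΔ s; have := hρ s; have := hsqpos s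
      positivity
    have := mul_nonneg (hc s) h1.le
    refine this.trans_eq ?_
    ring
  · intro s
    have hr := hb s
    refine sq_le_sq' ?_ ?_
    · linarith [neg_abs_le r₁, le_abs_self c, abs_nonneg r₂]
    · linarith [le_abs_self r₂, neg_abs_le c, abs_nonneg r₁]

end Curves

/-! ### Curves in immersed hypersurfaces -/

section CurveCalculus

variable {E F : Type*} [NormedAddCommGroup E] [NormedSpace ℝ E] [NormedAddCommGroup F]
  [NormedSpace ℝ F] {φ : E → F} {c : ℝ → E} {s : ℝ}

theorem contDiffAt_deriv (hc : ContDiffAt ℝ ∞ c s) : ContDiffAt ℝ ∞ (deriv c) s := by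
  have h : ContDiffAt ℝ ∞ (fderiv ℝ c) s := hc.fderiv_right (by simp)
  exact h.clm_apply contDiffAt_const

theorem eventually_hasDerivAt_comp (hφ : ContDiffAt ℝ ∞ φ (c s)) (hc : ContDiffAt ℝ ∞ c s) :
    ∀ᶠ t in nhds s, HasDerivAt (φ ∘ c) (fderiv ℝ φ (c t) (deriv c t)) t := by
  have h1 : ∀ᶠ y in nhds (c s), ContDiffAt ℝ 1 φ y :=
    (hφ.of_le (by exact_mod_cast le_top)).eventually (by simp)
  have h2 : ∀ᶠ t in nhds s, ContDiffAt ℝ 1 c t :=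
    (hc.of_le (by exact_mod_cast le_top)).eventually (by simp)
  filter_upwards [hc.continuousAt.eventually h1, h2] with t ht1 ht2
  exact HasFDerivAt.comp_hasDerivAt t (ht1.differentiableAt (by simp)).hasFDerivAt
    (ht2.differentiableAt (by simp)).hasDerivAt

theorem deriv_comp_eq (hφ : ContDiffAt ℝ ∞ φ (c s)) (hc : ContDiffAt ℝ ∞ c s) :
    deriv (φ ∘ c) s = fderiv ℝ φ (c s) (deriv c s) :=
  (eventually_hasDerivAt_comp hφ hc).self_of_nhds.deriv

theorem differentiableAt_fderiv (hφ : ContDiffAt ℝ ∞ φ (c s)) :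
    DifferentiableAt ℝ (fderiv ℝ φ) (c s) :=
  (hφ.fderiv_right (m := ∞) (by simp)).differentiableAt (by simp)

theorem hasDerivAt_fderiv_comp (hφ : ContDiffAt ℝ ∞ φ (c s)) (hc : ContDiffAt ℝ ∞ c s)
    {z : ℝ → E} {z' : E} (hz : HasDerivAt z z' s) :
    HasDerivAt (fun t => fderiv ℝ φ (c t) (z t))
      (fderiv ℝ (fderiv ℝ φ) (c s) (deriv c s) (z s) + fderiv ℝ φ (c s) z') s := by
  have h1 : HasDerivAt (fun t => fderiv ℝ φ (c t)) (fderiv ℝ (fderiv ℝ φ) (c s) (deriv c s)) s :=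
    HasFDerivAt.comp_hasDerivAt (l := fderiv ℝ φ) s (differentiableAt_fderiv hφ).hasFDerivAt
      (hc.differentiableAt (by simp)).hasDerivAt
  exact h1.clm_apply hz

theorem deriv_deriv_comp_eq (hφ : ContDiffAt ℝ ∞ φ (c s)) (hc : ContDiffAt ℝ ∞ c s) :
    deriv (deriv (φ ∘ c)) s = fderiv ℝ (fderiv ℝ φ) (c s) (deriv c s) (deriv c s)
      + fderiv ℝ φ (c s) (deriv (deriv c) s) := by
  have h : deriv (φ ∘ c) =ᶠ[nhds s] fun t => fderiv ℝ φ (c t) (deriv c t) :=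
    (eventually_hasDerivAt_comp hφ hc).mono fun t ht => ht.deriv
  rw [h.deriv_eq]
  exact (hasDerivAt_fderiv_comp hφ hc
    ((contDiffAt_deriv hc).differentiableAt (by simp)).hasDerivAt).deriv

theorem fderiv_fderiv_symm {u : E} (hφ : ContDiffAt ℝ ∞ φ u) (v w : E) :
    fderiv ℝ (fderiv ℝ φ) u v w = fderiv ℝ (fderiv ℝ φ) u w v :=
  (hφ.isSymmSndFDerivAt (by
    rw [minSmoothness_of_isRCLikeNormedField]
    exact ENat.LEInfty.out)) v w

end CurveCalculus

theorem accel_congr {M a : ℝ} {x y : ℝ → Spacetime} {s : ℝ} (h : x =ᶠ[nhds s] y)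
    (n : Spacetime) : accel M a x s n = accel M a y s n := by
  simp only [accel, h.deriv.deriv_eq, h.deriv_eq, h.self_of_nhds]

/-- The covector `accel M a x s`. -/
def accelCLM (M a : ℝ) (x : ℝ → Spacetime) (s : ℝ) : Spacetime →L[ℝ] ℝ :=
  metricCLM M a (x s) (deriv (deriv x) s) + fderiv ℝ (metricCLM M a) (x s) (deriv x s) (deriv x s)
    - (1 / 2 : ℝ) • ((fderiv ℝ (metricCLM M a) (x s)).flip (deriv x s)).flip (deriv x s)

theorem accelCLM_apply {M a : ℝ} (haM : |a| < M) {x : ℝ → Spacetime} {s : ℝ}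
    (hs : x s ∈ DOC M a) (n : Spacetime) : accelCLM M a x s n = accel M a x s n := by
  rw [accel, christoffelFirst_eq (g := metric M a) (G := metricCLM M a) (fun _ _ _ => rfl)
    (differentiableAt_metricCLM haM hs)]
  simp [accelCLM, metricCLM_apply]
  ring

/-! ### Geodesic operator of a pulled back metric. -/

section PullBack

variable {E : Type*} [NormedAddCommGroup E] [NormedSpace ℝ E]

/-- The pull-back of the Kerr metric. -/
def pullMetric (M a : ℝ) (φ : E → Spacetime) (u : E) : E →L[ℝ] E →L[ℝ] ℝ :=
  (metricCLM M a (φ u)).bilinearComp (fderiv ℝ φ u) (fderiv ℝ φ u)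

variable {M a : ℝ} {φ : E → Spacetime}

theorem pullMetric_apply (u v w : E) :
    pullMetric M a φ u v w = metricCLM M a (φ u) (fderiv ℝ φ u v) (fderiv ℝ φ u w) := rfl

theorem contDiff_flip {A B C : Type*} [NormedAddCommGroup A] [NormedSpace ℝ A]
    [NormedAddCommGroup B] [NormedSpace ℝ B] [NormedAddCommGroup C] [NormedSpace ℝ C] :
    ContDiff ℝ ∞ (fun L : A →L[ℝ] B →L[ℝ] C => L.flip) := by
  refine IsBoundedLinearMap.contDiff ⟨⟨fun _ _ => rfl, fun _ _ => rfl⟩, 1, one_pos, fun L => ?_⟩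
  simp

theorem contDiffAt_pullMetric (haM : |a| < M) {u : E}
    (hφ : ContDiffAt ℝ ∞ φ u) (hu : φ u ∈ DOC M a) : ContDiffAt ℝ ∞ (pullMetric M a φ) u := by
  have h1 : ContDiffAt ℝ ∞ (fderiv ℝ φ) u := hφ.fderiv_right (by simp)
  have h2 : ContDiffAt ℝ ∞ (fun u => metricCLM M a (φ u)) u :=
    (contDiffAt_metricCLM haM hu).comp u hφ
  have h3 : ContDiffAt ℝ ∞ (fun u => (metricCLM M a (φ u)).comp (fderiv ℝ φ u)) u :=
    h2.clm_comp h1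
  have h4 : ContDiffAt ℝ ∞ (fun u => (((metricCLM M a (φ u)).comp (fderiv ℝ φ u)).flip.comp
      (fderiv ℝ φ u)).flip) u := by
    exact (contDiff_flip.contDiffAt).comp u ((contDiff_flip.contDiffAt.comp u h3).clm_comp h1)
  exact h4

/-- The geodesic operator of the pulled back metric is the tangential part of the one of the
ambient metric. -/
theorem pullMetric_geodesic_eq (haM : |a| < M) {c : ℝ → E} {s : ℝ}
    (hφ : ContDiffAt ℝ ∞ φ (c s)) (hc : ContDiffAt ℝ ∞ c s) (hs : φ (c s) ∈ DOC M a) (z : E) :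
    pullMetric M a φ (c s) (deriv (deriv c) s) z
      + christoffelFirst (fun u v w => pullMetric M a φ u v w) (c s) (deriv c s) (deriv c s) z
    = accel M a (φ ∘ c) s (fderiv ℝ φ (c s) z) := by
  have hG := (contDiffAt_pullMetric haM hφ hs).differentiableAt (by simp)
  have hcd := (hc.differentiableAt (by simp)).hasDerivAt
  have hcd' := ((contDiffAt_deriv hc).differentiableAt (by simp)).hasDerivAt
  have hx : ContDiffAt ℝ ∞ (φ ∘ c) s := hφ.comp s hc
  -- The function `g(x', dφ(z))` along the curve is differentiated in two ways, with the pulled back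
  -- metric and with the ambient one.
  have h1 := hasDerivAt_bilin hG hcd hcd' (hasDerivAt_const s z)
  have h2 := hasDerivAt_metric_velocity haM (x := φ ∘ c) hs (hx.differentiableAt (by simp))
    ((contDiffAt_deriv hx).differentiableAt (by simp))
    (hasDerivAt_fderiv_comp hφ hc (hasDerivAt_const s z))
  have h3 : (fun t => pullMetric M a φ (c t) (deriv c t) z) =ᶠ[nhds s]
      fun t => metric M a ((φ ∘ c) t) (deriv (φ ∘ c) t) (fderiv ℝ φ (c t) z) := by
    filter_upwards [eventually_hasDerivAt_comp hφ hc] with t ht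
    rw [ht.deriv]; rfl
  have h4 := h1.unique (h2.congr_of_eventuallyEq h3)
  have hline : HasDerivAt (fun τ : ℝ => c s + τ • z) z 0 := by
    simpa using ((hasDerivAt_id (0 : ℝ)).smul_const z).const_add (c s)
  have e0 : c s + (0 : ℝ) • z = c s := by simp
  have hcl : ContDiffAt ℝ ∞ (fun τ : ℝ => c s + τ • z) 0 :=
    (contDiff_const.add (contDiff_id.smul contDiff_const)).contDiffAt
  have h5 : fderiv ℝ (pullMetric M a φ) (c s) z (deriv c s) (deriv c s)
      = fderiv ℝ (metricCLM M a) (φ (c s)) (fderiv ℝ φ (c s) z) (fderiv ℝ φ (c s) (deriv c s))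
          (fderiv ℝ φ (c s) (deriv c s))
        + 2 * metric M a (φ (c s)) (fderiv ℝ φ (c s) (deriv c s))
          (fderiv ℝ (fderiv ℝ φ) (c s) z (deriv c s)) := by
    have ha := hasDerivAt_bilin (x := fun τ : ℝ => c s + τ • z) (s := 0)
      (by rw [e0]; exact hG) hline (hasDerivAt_const 0 (deriv c s)) (hasDerivAt_const 0 (deriv c s))
    have hφ' : ContDiffAt ℝ ∞ φ ((fun τ : ℝ => c s + τ • z) 0) := by simpa using hφ
    have hb1 := hasDerivAt_fderiv_comp hφ' hcl (hasDerivAt_const 0 (deriv c s))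
    have hb2 := (eventually_hasDerivAt_comp hφ' hcl).self_of_nhds
    have hb := hasDerivAt_bilin (G := metricCLM M a) (x := φ ∘ fun τ : ℝ => c s + τ • z)
      (by
        change DifferentiableAt ℝ _ (φ (c s + (0 : ℝ) • z))
        rw [e0]; exact differentiableAt_metricCLM haM hs)
      hb2 hb1 hb1
    have h6 := ha.unique hb
    simp only [hline.deriv, e0, Function.comp_apply, map_zero, add_zero,
      _root_.zero_apply] at h6
    rw [h6, metricCLM_comm M a (φ (c s)) (fderiv ℝ (fderiv ℝ φ) (c s) z (deriv c s)),
      metricCLM_apply]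
    ring
  rw [christoffelFirst_eq (fun _ _ _ => rfl) hG, h5]
  rw [deriv_comp_eq hφ hc, map_zero, add_zero, map_zero, add_zero] at h4
  rw [fderiv_fderiv_symm hφ z]
  simp only [Function.comp_apply] at h4 ⊢
  linarith

end PullBack

section Hypersurface

variable {E : Type*} [NormedAddCommGroup E] [NormedSpace ℝ E]
  {H : Type*} [TopologicalSpace H] {I : ModelWithCorners ℝ E H} [I.Boundaryless]
  {N : Type*} [TopologicalSpace N] [ChartedSpace H N] [IsManifold I ∞ N]
  {M a : ℝ} {f : N → Spacetime}

theorem localRep_extChartAt_self (p : N) : localRep I f p (extChartAt I p p) = f p := by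
  simp [localRep]

theorem contDiffAt_localRep (hf : ContMDiff I 𝓘(ℝ, Spacetime) ∞ f) {p : N} {u : E}
    (hu : u ∈ (extChartAt I p).target) : ContDiffAt ℝ ∞ (localRep I f p) u := by
  have h : ContMDiffOn 𝓘(ℝ, E) 𝓘(ℝ, Spacetime) ∞ (localRep I f p) (extChartAt I p).target :=
    hf.comp_contMDiffOn (contMDiffOn_extChartAt_symm p)
  exact (contMDiffOn_iff_contDiffOn.1 h).contDiffAt ((isOpen_extChartAt_target p).mem_nhds hu)

theorem contDiffAt_localRep_self (hf : ContMDiff I 𝓘(ℝ, Spacetime) ∞ f) (p : N) :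
    ContDiffAt ℝ ∞ (localRep I f p) (extChartAt I p p) :=
  contDiffAt_localRep hf (mem_extChartAt_target p)

theorem fderiv_localRep_injective (hf : IsImmersedIn I M a f) (p : N) :
    Function.Injective (fderiv ℝ (localRep I f p) (extChartAt I p p)) := by
  have h := hf.immersion p
  have hd : MDifferentiableAt I 𝓘(ℝ, Spacetime) f p :=
    (hf.smooth p).mdifferentiableAt (by simp)
  rw [hd.mfderiv, I.range_eq_univ, fderivWithin_univ] at h
  exact h

/-- Change of charts for the differential of an immersion. -/
theorem exists_fderiv_localRep_eq (hf : ContMDiff I 𝓘(ℝ, Spacetime) ∞ f) {p q : N} {u : E}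
    (hu : u ∈ (extChartAt I p).target) (hq : (extChartAt I p).symm u ∈ (extChartAt I q).source) :
    ∃ T : E →L[ℝ] E, ∀ z, fderiv ℝ (localRep I f p) u z
      = fderiv ℝ (localRep I f q) (extChartAt I q ((extChartAt I p).symm u)) (T z) := by
  set τ : E → E := extChartAt I q ∘ (extChartAt I p).symm with hτ
  have h1 : ContDiffWithinAt ℝ ∞ τ (Set.range I) u := by
    apply contDiffWithinAt_ext_coord_change q p
    rw [PartialEquiv.trans_source]
    exact ⟨hu, hq⟩
  rw [I.range_eq_univ, contDiffWithinAt_univ] at h1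
  have hcs : ContinuousAt (extChartAt I p).symm u := continuousAt_extChartAt_symm'' hu
  have h2 : localRep I f p =ᶠ[nhds u] localRep I f q ∘ τ := by
    filter_upwards [hcs.eventually ((isOpen_extChartAt_source q).mem_nhds hq)] with y hy
    simp only [localRep, hτ, Function.comp_apply]
    rw [(extChartAt I q).left_inv hy]
  refine ⟨fderiv ℝ τ u, fun z => ?_⟩
  have h3 : ContDiffAt ℝ ∞ (localRep I f q) (τ u) :=
    contDiffAt_localRep hf ((extChartAt I q).map_source hq)
  rw [h2.fderiv_eq, fderiv_comp u (h3.differentiableAt (by simp)) (h1.differentiableAt (by simp))]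
  rfl

theorem contDiffAt_chart_comp {γ : ℝ → N} {s : ℝ} {p : N} (hγ : ContMDiffAt 𝓘(ℝ, ℝ) I ∞ γ s)
    (hp : γ s ∈ (extChartAt I p).source) : ContDiffAt ℝ ∞ (extChartAt I p ∘ γ) s := by
  rw [← contMDiffAt_iff_contDiffAt]
  have h : ContMDiffAt I 𝓘(ℝ, E) ∞ (extChartAt I p) (γ s) :=
    contMDiffAt_extChartAt' (by rwa [extChartAt_source] at hp)
  exact h.comp s hγ

theorem comp_eventuallyEq_localRep {γ : ℝ → N} {s : ℝ} {p : N} (hγ : ContinuousAt γ s)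
    (hp : γ s ∈ (extChartAt I p).source) :
    f ∘ γ =ᶠ[nhds s] localRep I f p ∘ (extChartAt I p ∘ γ) := by
  filter_upwards [hγ.eventually ((isOpen_extChartAt_source p).mem_nhds hp)] with t ht
  simp only [localRep, Function.comp_apply]
  rw [(extChartAt I p).left_inv ht]

theorem deriv_comp_eq_localRep (hf : ContMDiff I 𝓘(ℝ, Spacetime) ∞ f) {γ : ℝ → N} {s : ℝ} {p : N}
    (hγ : ContMDiffAt 𝓘(ℝ, ℝ) I ∞ γ s) (hp : γ s ∈ (extChartAt I p).source) :
    deriv (f ∘ γ) s = fderiv ℝ (localRep I f p) (extChartAt I p (γ s))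
      (deriv (extChartAt I p ∘ γ) s) := by
  rw [(comp_eventuallyEq_localRep (f := f) hγ.continuousAt hp).deriv_eq]
  exact deriv_comp_eq (contDiffAt_localRep hf ((extChartAt I p).map_source hp))
    (contDiffAt_chart_comp hγ hp)

/-- In any chart, the geodesic operator of the induced metric is the tangential part of the
ambient one. -/
theorem inducedMetric_geodesic_eq [FiniteDimensional ℝ E] (haM : |a| < M)
    (hf : ContMDiff I 𝓘(ℝ, Spacetime) ∞ f) (hD : ∀ p, f p ∈ DOC M a) {γ : ℝ → N} {s : ℝ} {p : N}
    (hγ : ContMDiffAt 𝓘(ℝ, ℝ) I ∞ γ s) (hp : γ s ∈ (extChartAt I p).source) (z : E) :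
    inducedMetric I M a f p (extChartAt I p (γ s)) (deriv (deriv (extChartAt I p ∘ γ)) s) z
      + christoffelFirst (inducedMetric I M a f p) (extChartAt I p (γ s))
          (deriv (extChartAt I p ∘ γ) s) (deriv (extChartAt I p ∘ γ) s) z
      = accel M a (f ∘ γ) s (fderiv ℝ (localRep I f p) (extChartAt I p (γ s)) z) := by
  rw [accel_congr (comp_eventuallyEq_localRep (f := f) hγ.continuousAt hp)]
  exact pullMetric_geodesic_eq haM (c := extChartAt I p ∘ γ) (s := s)
    (contDiffAt_localRep hf ((extChartAt I p).map_source hp)) (contDiffAt_chart_comp hγ hp)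
    (hD _) z

/-- Along a normal vector, the ambient acceleration of a null curve in an umbilical hypersurface
vanishes. -/
theorem accel_normal_eq_zero (hf : ContMDiff I 𝓘(ℝ, Spacetime) ∞ f) (hu : IsUmbilical I M a f)
    {γ : ℝ → N} {s : ℝ} (hγ : ContMDiffAt 𝓘(ℝ, ℝ) I ∞ γ s)
    (hnull : inducedMetric I M a f (γ s) (extChartAt I (γ s) (γ s))
      (deriv (extChartAt I (γ s) ∘ γ) s) (deriv (extChartAt I (γ s) ∘ γ) s) = 0)
    {n : Spacetime} (hn : ∀ v : E, metric M a (f (γ s))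
      (fderiv ℝ (localRep I f (γ s)) (extChartAt I (γ s) (γ s)) v) n = 0) :
    accel M a (f ∘ γ) s n = 0 := by
  have hp := mem_extChartAt_source (I := I) (γ s)
  obtain ⟨c, hc⟩ := hu (γ s) n hn
  have hφ := contDiffAt_localRep_self (I := I) hf (γ s)
  have hcc := contDiffAt_chart_comp hγ hp
  -- Umbilicity on a null velocity: the normal component of the acceleration is a multiple of the
  -- vanishing first fundamental form.
  have h1 := hc (deriv (extChartAt I (γ s) ∘ γ) s) (deriv (extChartAt I (γ s) ∘ γ) s)
  rw [hnull, mul_zero, secondFundamentalForm] at h1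
  have h2 := deriv_deriv_comp_eq (φ := localRep I f (γ s)) (c := extChartAt I (γ s) ∘ γ) (s := s)
    hφ hcc
  have h3 := deriv_comp_eq (φ := localRep I f (γ s)) (c := extChartAt I (γ s) ∘ γ) (s := s)
    hφ hcc
  rw [accel_congr (comp_eventuallyEq_localRep (f := f) hγ.continuousAt hp), accel, h2, h3]
  simp only [Function.comp_apply, localRep_extChartAt_self]
  rw [metric_add, hn, add_zero]
  exact h1

/-- A covector that vanishes on the tangent space and on the normal space of a nondegenerate
hypersurface is zero. -/
theorem eq_zero_of_tangent_of_normal {p : N}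
    (ht : IsLorentzian₃ (inducedMetric I M a f p (extChartAt I p p))) (A : Spacetime →L[ℝ] ℝ)
    (hA : ∀ z, A (fderiv ℝ (localRep I f p) (extChartAt I p p) z) = 0)
    (hN : ∀ n, (∀ v : E, metric M a (f p)
      (fderiv ℝ (localRep I f p) (extChartAt I p p) v) n = 0) → A n = 0) : A = 0 := by
  obtain ⟨e, he⟩ := ht
  refine ContinuousLinearMap.ext fun n => ?_
  set D := fderiv ℝ (localRep I f p) (extChartAt I p p) with hD
  set η : Fin 3 → ℝ := fun i => if i = 0 then -1 else 1 with hη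
  -- Coordinates of the orthogonal projection of `n` to the tangent space, in a Lorentz basis; the
  -- signs `η i` are the squares of the basis vectors.
  set w : E := ∑ i, (η i * metricCLM M a (f p) (D (e i)) n) • e i with hw
  have hnorm : A (n - D w) = 0 := by
    refine hN _ fun v => ?_
    have key : (metricCLM M a (f p)).flip (n - D w) ∘L D = 0 := by
      refine ContinuousLinearMap.coe_injective (e.ext fun i => ?_)
      change metricCLM M a (f p) (D (e i)) (n - D w) = 0
      simp only [map_sub, hw, map_sum, map_smul]
      have h2 : ∀ j, metricCLM M a (f p) (D (e i)) (D (e j))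
          = if i = j then η i else 0 := fun j => by
        have := he i j
        rw [inducedMetric, localRep_extChartAt_self] at this
        exact this
      simp only [h2, smul_eq_mul, mul_ite, mul_zero, Finset.sum_ite_eq, Finset.mem_univ, if_true]
      have h3 : η i * η i = 1 := by simp only [hη]; split_ifs <;> norm_num
      linear_combination -(metricCLM M a (f p) (D (e i)) n) * h3
    exact DFunLike.congr_fun key v
  rw [map_sub, hA, sub_zero] at hnorm
  simpa using hnorm

/-- Null geodesics of an umbilical timelike hypersurface are geodesics of the spacetime. -/
theorem accel_eq_zero [FiniteDimensional ℝ E] (haM : |a| < M) (hf : IsImmersedIn I M a f)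
    (ht : IsTimelike I M a f) (hu : IsUmbilical I M a f) {γ : ℝ → N} {J : Set ℝ} (hJ : IsOpen J)
    (hγ : IsNullGeodesicOn I M a f γ J) {s : ℝ} (hs : s ∈ J) (n : Spacetime) :
    accel M a (f ∘ γ) s n = 0 := by
  have hγs : ContMDiffAt 𝓘(ℝ, ℝ) I ∞ γ s := (hγ.smooth s hs).contMDiffAt (hJ.mem_nhds hs)
  have hD : (f ∘ γ) s ∈ DOC M a := hf.mem_DOC (γ s)
  have h0 : accelCLM M a (f ∘ γ) s = 0 := by
    refine eq_zero_of_tangent_of_normal (I := I) (ht (γ s)) _ (fun z => ?_) (fun n hn => ?_)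
    · rw [accelCLM_apply haM hD, ← inducedMetric_geodesic_eq haM hf.smooth hf.mem_DOC hγs
        (mem_extChartAt_source (γ s))]
      exact hγ.geodesic s hs z
    · rw [accelCLM_apply haM hD]
      exact accel_normal_eq_zero hf.smooth hu hγs (hγ.null s hs) hn
  rw [← accelCLM_apply haM hD, h0]; rfl

/-- A complete null geodesic of an umbilical timelike hypersurface, with compactly bounded
quotient, has constant radius. -/
theorem dr_null_velocity_eq_zero [FiniteDimensional ℝ E] (haM : |a| < M)
    (hf : IsImmersedIn I M a f)
    (ht : IsTimelike I M a f) (hu : IsUmbilical I M a f) (hb : HasCompactlyBoundedQuotient M a f)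
    {γ : ℝ → N} (hγ : IsNullGeodesicOn I M a f γ Set.univ) (s : ℝ) :
    dr (f (γ s)) (fderiv ℝ (localRep I f (γ s)) (extChartAt I (γ s) (γ s))
      (deriv (extChartAt I (γ s) ∘ γ) s)) = 0 := by
  have hγs : ∀ s, ContMDiffAt 𝓘(ℝ, ℝ) I ∞ γ s := fun s =>
    (hγ.smooth s (Set.mem_univ s)).contMDiffAt Filter.univ_mem
  have hv := fun s => deriv_comp_eq_localRep hf.smooth (hγs s) (mem_extChartAt_source (γ s))
  obtain ⟨K, hK, hKD, hfK⟩ := hb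
  have hKne : K.Nonempty := ⟨_, hfK (γ 0)⟩
  obtain ⟨k₁, hk₁, hmin⟩ := hK.exists_isMinOn hKne continuous_norm.continuousOn
  obtain ⟨k₂, hk₂, hmax⟩ := hK.exists_isMaxOn hKne continuous_norm.continuousOn
  have hx : ContDiff ℝ ∞ (f ∘ γ) := by
    rw [← contMDiff_iff_contDiff]
    exact fun s => (hf.smooth (γ s)).comp s (hγs s)
  rw [← hv]
  refine dr_velocity_eq_zero haM (x := f ∘ γ) (hKD hk₁) (r₂ := ‖k₂‖)
    (hx.of_le ENat.LEInfty.out)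
    (fun s => ⟨hmin (hfK (γ s)), hmax (hfK (γ s))⟩)
    (fun s n => accel_eq_zero haM hf ht hu isOpen_univ hγ (Set.mem_univ s) n) (fun s => ?_)
    (fun s => ?_) s
  · rw [hv]
    intro h
    exact hγ.velocity_ne_zero s (Set.mem_univ s)
      ((fderiv_localRep_injective hf (γ s)) (by rw [h, map_zero]))
  · have h := hγ.null s (Set.mem_univ s)
    rw [inducedMetric, localRep_extChartAt_self, ← hv] at h
    exact h

end Hypersurface

/-! ### Existence of maximal null geodesics -/

/-- Local existence of smooth solutions of a smooth autonomous differential equation. -/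
theorem exists_smooth_solution {X : Type*} [NormedAddCommGroup X] [NormedSpace ℝ X]
    [CompleteSpace X] {V : X → X} {Ω : Set X} (hΩ : IsOpen Ω)
    (hV : ContDiffOn ℝ ∞ V Ω) {y₀ : X} (hy₀ : y₀ ∈ Ω) :
    ∃ ε > 0, ∃ y : ℝ → X, y 0 = y₀ ∧ (∀ t ∈ Set.Ioo (-ε) ε, y t ∈ Ω) ∧
      (∀ t ∈ Set.Ioo (-ε) ε, HasDerivAt y (V (y t)) t) ∧ ContDiffOn ℝ ∞ y (Set.Ioo (-ε) ε) := by
  have hV₀ : ContDiffAt ℝ 1 V y₀ :=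
    ((hV.contDiffAt (hΩ.mem_nhds hy₀)).of_le (by exact_mod_cast le_top))
  obtain ⟨r, hr, ε, hε, h⟩ :=
    hV₀.exists_forall_mem_closedBall_exists_eq_forall_mem_Ioo_hasDerivAt 0
  obtain ⟨y, hy0, hy⟩ := h y₀ (Metric.mem_closedBall_self hr.le)
  simp only [zero_sub, zero_add] at hy
  have hc : ContinuousAt y 0 := (hy 0 ⟨by linarith, hε⟩).continuousAt
  have hev : ∀ᶠ t in nhds 0, y t ∈ Ω := hc.eventually (hΩ.mem_nhds (by rwa [hy0]))
  obtain ⟨δ, hδ, hball⟩ := Metric.eventually_nhds_iff.1 hev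
  have hy' : ∀ t ∈ Set.Ioo (-(min ε δ)) (min ε δ), HasDerivAt y (V (y t)) t := fun t ht =>
    hy t ⟨by linarith [ht.1, min_le_left ε δ], by linarith [ht.2, min_le_left ε δ]⟩
  have hmem : ∀ t ∈ Set.Ioo (-(min ε δ)) (min ε δ), y t ∈ Ω := fun t ht => hball (by
    rw [Real.dist_eq, sub_zero, abs_lt]
    exact ⟨by linarith [ht.1, min_le_right ε δ], by linarith [ht.2, min_le_right ε δ]⟩)
  refine ⟨min ε δ, lt_min hε hδ, y, hy0, hmem, hy', ?_⟩
  -- Bootstrap: if `y` is of class `C^n`, so is `y' = V ∘ y`, hence `y` is of class `C^(n+1)`.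
  have key : ∀ n : ℕ, ContDiffOn ℝ n y (Set.Ioo (-(min ε δ)) (min ε δ)) := by
    intro n
    induction n with
    | zero =>
      exact contDiffOn_zero.2 fun t ht => (hy' t ht).continuousAt.continuousWithinAt
    | succ n ih =>
      push_cast
      rw [contDiffOn_succ_iff_deriv_of_isOpen isOpen_Ioo]
      refine ⟨fun t ht => (hy' t ht).differentiableAt.differentiableWithinAt, by simp, ?_⟩
      have h1 : ContDiffOn ℝ n (V ∘ y) (Set.Ioo (-(min ε δ)) (min ε δ)) :=
        (hV.of_le (by exact_mod_cast le_top)).comp ih hmem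
      exact h1.congr fun t ht => (hy' t ht).deriv
  exact contDiffOn_infty.2 key

set_option maxSynthPendingDepth 3 in
theorem contDiffAt_flip_flip_apply {X A B C : Type*} [NormedAddCommGroup X] [NormedSpace ℝ X]
    [NormedAddCommGroup A] [NormedSpace ℝ A] [NormedAddCommGroup B] [NormedSpace ℝ B]
    [NormedAddCommGroup C] [NormedSpace ℝ C] {L : X → A →L[ℝ] B →L[ℝ] B →L[ℝ] C} {w : X → B}
    {x : X} (hL : ContDiffAt ℝ ∞ L x) (hw : ContDiffAt ℝ ∞ w x) :
    ContDiffAt ℝ ∞ (fun y => ((L y).flip (w y)).flip (w y)) x := by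
  have h1 : ContDiffAt ℝ ∞ (fun y => (L y).flip) x :=
    (contDiff_flip (A := A) (B := B) (C := B →L[ℝ] C)).contDiffAt.comp x hL
  have h2 : ContDiffAt ℝ ∞ (fun y => (L y).flip (w y)) x := h1.clm_apply hw
  have h3 : ContDiffAt ℝ ∞ (fun y => ((L y).flip (w y)).flip) x :=
    (contDiff_flip (A := A) (B := B) (C := C)).contDiffAt.comp x h2
  exact h3.clm_apply hw

section Spray

variable {E : Type*} [NormedAddCommGroup E] [NormedSpace ℝ E] [FiniteDimensional ℝ E]
  {M a : ℝ} {φ : E → Spacetime}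

/-- The covector `Γ(v, v)` of the pulled back metric. -/
def christoffelCLM (h : E → E →L[ℝ] E →L[ℝ] ℝ) (u v : E) : E →L[ℝ] ℝ :=
  fderiv ℝ h u v v - (1 / 2 : ℝ) • ((fderiv ℝ h u).flip v).flip v

theorem christoffelCLM_apply {h : E → E →L[ℝ] E →L[ℝ] ℝ} {u : E} (hh : DifferentiableAt ℝ h u)
    (v z : E) :
    christoffelCLM h u v z = christoffelFirst (fun u v w => h u v w) u v v z := by
  rw [christoffelFirst_eq (fun _ _ _ => rfl) hh]
  simp [christoffelCLM]
  ring

/-- The geodesic equation of the pulled back metric, as a first order equation. -/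
def spray (h : E → E →L[ℝ] E →L[ℝ] ℝ) (y : E × E) : E × E :=
  (y.2, -((h y.1).inverse (christoffelCLM h y.1 y.2)))

set_option maxSynthPendingDepth 3 in
theorem contDiffAt_christoffelCLM {h : E → E →L[ℝ] E →L[ℝ] ℝ} {y : E × E}
    (hh : ContDiffAt ℝ ∞ h y.1) :
    ContDiffAt ℝ ∞ (fun y : E × E => christoffelCLM h y.1 y.2) y := by
  have h0 : ContDiffAt ℝ ∞ (fderiv ℝ h) y.1 := hh.fderiv_right (by simp)
  have h3 : ContDiffAt ℝ ∞ (fun y : E × E => fderiv ℝ h y.1) y :=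
    ContDiffAt.comp (g := fderiv ℝ h) (f := Prod.fst) y h0 contDiffAt_fst
  have h4 : ContDiffAt ℝ ∞ (fun y : E × E => fderiv ℝ h y.1 y.2) y :=
    h3.clm_apply contDiffAt_snd
  have h5 : ContDiffAt ℝ ∞ (fun y : E × E => fderiv ℝ h y.1 y.2 y.2) y :=
    h4.clm_apply contDiffAt_snd
  have h6 : ContDiffAt ℝ ∞ (fun y : E × E => ((fderiv ℝ h y.1).flip y.2).flip y.2) y :=
    contDiffAt_flip_flip_apply (A := E) (B := E) (C := ℝ) h3 contDiffAt_snd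
  exact h5.sub (h6.const_smul (1 / 2 : ℝ))

theorem contDiffAt_spray {h : E → E →L[ℝ] E →L[ℝ] ℝ} {y : E × E}
    (hh : ContDiffAt ℝ ∞ h y.1) (hinv : h y.1 ∈ Set.range ((↑) : (E ≃L[ℝ] (E →L[ℝ] ℝ)) → _)) :
    ContDiffAt ℝ ∞ (spray h) y := by
  obtain ⟨e, he⟩ := hinv
  have : CompleteSpace E := FiniteDimensional.complete ℝ E
  have h0 : ContDiffAt ℝ ∞ (fun y : E × E => h y.1) y :=
    ContDiffAt.comp (g := h) (f := Prod.fst) y hh contDiffAt_fst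
  have h2 : ContDiffAt ℝ ∞ ContinuousLinearMap.inverse (h y.1) := by
    rw [← he]; exact contDiffAt_map_inverse e
  have h1 : ContDiffAt ℝ ∞ (fun y : E × E => (h y.1).inverse) y :=
    ContDiffAt.comp (g := ContinuousLinearMap.inverse) (f := fun y : E × E => h y.1) y h2 h0
  have h3 : ContDiffAt ℝ ∞ (fun y : E × E => (h y.1).inverse (christoffelCLM h y.1 y.2)) y :=
    h1.clm_apply (contDiffAt_christoffelCLM hh)
  exact contDiffAt_snd.prodMk h3.neg

end Spray

section Hypersurface

variable {E : Type*} [NormedAddCommGroup E] [NormedSpace ℝ E]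
  {H : Type*} [TopologicalSpace H] {I : ModelWithCorners ℝ E H} [I.Boundaryless]
  {N : Type*} [TopologicalSpace N] [ChartedSpace H N] [IsManifold I ∞ N]
  {M a : ℝ} {f : N → Spacetime}

/-- A Lorentzian form is nondegenerate. -/
theorem isLorentzian₃_injective {b : E →L[ℝ] E →L[ℝ] ℝ} (hb : IsLorentzian₃ fun v w => b v w) :
    Function.Injective b := by
  obtain ⟨e, he⟩ := hb
  rw [injective_iff_map_eq_zero]
  intro w hw
  refine e.repr.map_eq_zero_iff.1 (Finsupp.ext fun i => ?_)
  have h : b w (e i) = 0 := by rw [hw]; rfl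
  rw [← e.sum_repr w, map_sum, sum_apply] at h
  simp only [map_smul, smul_apply, he, smul_eq_mul, mul_ite, mul_zero,
    Finset.sum_ite_eq', Finset.mem_univ, if_true] at h
  split_ifs at h <;> simpa using h

theorem exists_equiv_of_injective [FiniteDimensional ℝ E] {b : E →L[ℝ] E →L[ℝ] ℝ}
    (hb : Function.Injective b) : b ∈ Set.range ((↑) : (E ≃L[ℝ] (E →L[ℝ] ℝ)) → _) := by
  have hfin : Module.finrank ℝ E = Module.finrank ℝ (E →L[ℝ] ℝ) := by
    rw [← (LinearMap.toContinuousLinearMap : (E →ₗ[ℝ] ℝ) ≃ₗ[ℝ] (E →L[ℝ] ℝ)).finrank_eq]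
    exact Subspace.dual_finrank_eq.symm
  refine ⟨(LinearEquiv.ofInjectiveOfFinrankEq b.toLinearMap hb hfin).toContinuousLinearEquiv, ?_⟩
  ext v w
  rfl

/-- Through every null vector there is a local null geodesic. -/
theorem exists_local_nullGeodesic [FiniteDimensional ℝ E] (haM : |a| < M)
    (hf : IsImmersedIn I M a f) (ht : IsTimelike I M a f) (p : N) {v : E} (hv : v ≠ 0)
    (hnull : inducedMetric I M a f p (extChartAt I p p) v v = 0) :
    ∃ ε > 0, ∃ γ : ℝ → N, γ 0 = p ∧ deriv (extChartAt I p ∘ γ) 0 = v ∧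
      IsNullGeodesicOn I M a f γ (Set.Ioo (-ε) ε) := by
  have : CompleteSpace E := FiniteDimensional.complete ℝ E
  set h := pullMetric M a (localRep I f p) with hh
  have hsm : ∀ u ∈ (extChartAt I p).target, ContDiffAt ℝ ∞ h u := fun u hu =>
    contDiffAt_pullMetric haM (contDiffAt_localRep hf.smooth hu) (hf.mem_DOC _)
  have htar := isOpen_extChartAt_target (I := I) p
  -- The spray is smooth where the metric is invertible, which is an open condition. The factor
  -- `{0}ᶜ` in `Ω` keeps the velocity nonzero along the solution.
  set U : Set E := (extChartAt I p).target ∩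
    h ⁻¹' Set.range ((↑) : (E ≃L[ℝ] (E →L[ℝ] ℝ)) → _) with hU
  have hUo : IsOpen U := ContinuousOn.isOpen_inter_preimage
    (fun u hu => (hsm u hu).continuousAt.continuousWithinAt) htar ContinuousLinearEquiv.isOpen
  set Ω : Set (E × E) := U ×ˢ {0}ᶜ with hΩ
  have hΩo : IsOpen Ω := hUo.prod isOpen_compl_singleton
  have hV : ContDiffOn ℝ ∞ (spray h) Ω := fun y hy =>
    (contDiffAt_spray (hsm _ hy.1.1) hy.1.2).contDiffWithinAt
  obtain ⟨ε, hε, y, hy0, hyΩ, hy, hys⟩ := exists_smooth_solution hΩo hV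
    (y₀ := (extChartAt I p p, v))
    ⟨⟨mem_extChartAt_target p, exists_equiv_of_injective (isLorentzian₃_injective (ht p))⟩, hv⟩
  have h0 : (0 : ℝ) ∈ Set.Ioo (-ε) ε := ⟨by linarith, hε⟩
  set c : ℝ → E := fun t => (y t).1 with hc
  set γ : ℝ → N := fun t => (extChartAt I p).symm (c t) with hγ
  have hcd : ∀ t ∈ Set.Ioo (-ε) ε, HasDerivAt c (y t).2 t := fun t ht =>
    (ContinuousLinearMap.fst ℝ E E).hasFDerivAt.comp_hasDerivAt t (hy t ht)
  have hcdd : ∀ t ∈ Set.Ioo (-ε) ε, HasDerivAt (fun t => (y t).2)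
      (-((h (c t)).inverse (christoffelCLM h (c t) (y t).2))) t := fun t ht =>
    (ContinuousLinearMap.snd ℝ E E).hasFDerivAt.comp_hasDerivAt t (hy t ht)
  have hcs : ∀ t ∈ Set.Ioo (-ε) ε, ContDiffAt ℝ ∞ c t := fun t ht =>
    (hys.contDiffAt (isOpen_Ioo.mem_nhds ht)).fst
  have hct : ∀ t ∈ Set.Ioo (-ε) ε, c t ∈ (extChartAt I p).target := fun t ht => (hyΩ t ht).1.1
  have hγs : ∀ t ∈ Set.Ioo (-ε) ε, ContMDiffAt 𝓘(ℝ, ℝ) I ∞ γ t := fun t ht =>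
    ((contMDiffOn_extChartAt_symm p).contMDiffAt (htar.mem_nhds (hct t ht))).comp t
      (hcs t ht).contMDiffAt
  have hγp : ∀ t ∈ Set.Ioo (-ε) ε, γ t ∈ (extChartAt I p).source := fun t ht =>
    (extChartAt I p).map_target (hct t ht)
  have hcγ : ∀ t ∈ Set.Ioo (-ε) ε, extChartAt I p (γ t) = c t := fun t ht =>
    (extChartAt I p).right_inv (hct t ht)
  have hcγ' : ∀ t ∈ Set.Ioo (-ε) ε, extChartAt I p ∘ γ =ᶠ[nhds t] c := fun t ht =>
    Filter.eventually_of_mem (isOpen_Ioo.mem_nhds ht) hcγ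
  have hd1 : ∀ t ∈ Set.Ioo (-ε) ε, deriv (extChartAt I p ∘ γ) t = (y t).2 := fun t ht => by
    rw [(hcγ' t ht).deriv_eq, (hcd t ht).deriv]
  have hd2 : ∀ t ∈ Set.Ioo (-ε) ε, deriv (deriv (extChartAt I p ∘ γ)) t
      = -((h (c t)).inverse (christoffelCLM h (c t) (y t).2)) := fun t ht => by
    have : deriv (extChartAt I p ∘ γ) =ᶠ[nhds t] fun t => (y t).2 :=
      Filter.eventually_of_mem (isOpen_Ioo.mem_nhds ht) hd1
    rw [this.deriv_eq, (hcdd t ht).deriv]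
  -- The geodesic equation is recast as vanishing of the tangential ambient acceleration, a
  -- formulation independent of the chart. The definition of a geodesic uses the chart at each `γ
  -- t`, whereas the solution lives in the chart at `p`.
  have htan : ∀ t ∈ Set.Ioo (-ε) ε, ∀ z,
      accel M a (f ∘ γ) t (fderiv ℝ (localRep I f p) (c t) z) = 0 := by
    intro t ht z
    rw [← hcγ t ht, ← inducedMetric_geodesic_eq haM hf.smooth hf.mem_DOC (hγs t ht) (hγp t ht),
      hd1 t ht, hd2 t ht, hcγ t ht]
    obtain ⟨e, he⟩ := (hyΩ t ht).1.2
    have h1 := christoffelCLM_apply ((hsm _ (hct t ht)).differentiableAt (by simp)) (y t).2 z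
    have h2 : h (c t) ((h (c t)).inverse (christoffelCLM h (c t) (y t).2))
        = christoffelCLM h (c t) (y t).2 := by
      have he' : h (c t) = e := he.symm
      rw [he', ContinuousLinearMap.inverse_equiv]
      exact e.apply_symm_apply _
    change h (c t) (-((h (c t)).inverse (christoffelCLM h (c t) (y t).2))) z
      + christoffelFirst (fun u v w => h u v w) (c t) (y t).2 (y t).2 z = 0
    rw [map_neg, h2, ← h1]
    simp
  have hxs : ∀ t ∈ Set.Ioo (-ε) ε, ContDiffAt ℝ ∞ (f ∘ γ) t := fun t ht => by
    rw [← contMDiffAt_iff_contDiffAt]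
    exact (hf.smooth (γ t)).comp t (hγs t ht)
  have hx1 : ∀ t ∈ Set.Ioo (-ε) ε,
      deriv (f ∘ γ) t = fderiv ℝ (localRep I f p) (c t) (y t).2 := fun t ht => by
    rw [deriv_comp_eq_localRep hf.smooth (hγs t ht) (hγp t ht), hcγ t ht, hd1 t ht]
  -- The derivative of `g(x', x')` is twice the acceleration tested on the tangent vector `x'`, so
  -- nullness propagates from time `0`.
  have hnl : ∀ t ∈ Set.Ioo (-ε) ε,
      metric M a ((f ∘ γ) t) (deriv (f ∘ γ) t) (deriv (f ∘ γ) t) = 0 := by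
    have hder : ∀ t ∈ Set.Ioo (-ε) ε, HasDerivAt
        (fun t => metric M a ((f ∘ γ) t) (deriv (f ∘ γ) t) (deriv (f ∘ γ) t)) 0 t := by
      intro t ht
      have hD : (f ∘ γ) t ∈ DOC M a := hf.mem_DOC _
      have h1 := ((hxs t ht).differentiableAt (by simp)).hasDerivAt
      have h2 := ((contDiffAt_deriv (hxs t ht)).differentiableAt (by simp)).hasDerivAt
      have h3 := hasDerivAt_bilin (differentiableAt_metricCLM haM hD) h1 h2 h2
      refine h3.congr_deriv ?_
      have h4 := htan t ht (y t).2
      rw [← hx1 t ht, accel, christoffelFirst_eq (g := metric M a) (G := metricCLM M a)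
        (fun _ _ _ => rfl) (differentiableAt_metricCLM haM hD)] at h4
      rw [metricCLM_comm M a ((f ∘ γ) t) (deriv (f ∘ γ) t), metricCLM_apply]
      linarith
    intro t ht
    have h5 : (fun t => metric M a ((f ∘ γ) t) (deriv (f ∘ γ) t) (deriv (f ∘ γ) t)) t
        = (fun t => metric M a ((f ∘ γ) t) (deriv (f ∘ γ) t) (deriv (f ∘ γ) t)) 0 :=
      isOpen_Ioo.is_const_of_deriv_eq_zero isPreconnected_Ioo
        (fun t ht => (hder t ht).differentiableAt.differentiableWithinAt)
        (fun t ht => (hder t ht).deriv) ht h0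
    simp only at h5
    rw [h5, hx1 0 h0]
    have e1 : c 0 = extChartAt I p p := by simp only [hc, hy0]
    have e2 : (f ∘ γ) 0 = localRep I f p (c 0) := rfl
    rw [e2, e1, hy0]
    exact hnull
  refine ⟨ε, hε, γ, ?_, ?_, ?_, ?_, ?_, ?_⟩
  · simp only [hγ, hc, hy0, extChartAt_to_inv]
  · rw [hd1 0 h0, hy0]
  · exact fun t ht => (hγs t ht).contMDiffWithinAt
  · intro t ht z
    have hq := mem_extChartAt_source (I := I) (γ t)
    rw [inducedMetric_geodesic_eq haM hf.smooth hf.mem_DOC (hγs t ht) hq]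
    have hqs : (extChartAt I (γ t)).symm (extChartAt I (γ t) (γ t)) = γ t := extChartAt_to_inv _
    obtain ⟨T, hT⟩ := exists_fderiv_localRep_eq hf.smooth (p := γ t) (q := p)
      (mem_extChartAt_target (γ t)) (by rw [hqs]; exact hγp t ht)
    rw [hT, hqs, hcγ t ht]
    exact htan t ht _
  -- A zero velocity in the chart at `γ t` gives `(f ∘ γ)' = 0`; invertibility of the pulled back
  -- metric then forces the velocity in the chart at `p` to vanish, which `Ω` excludes.
  · intro t ht hzero
    have h1 := deriv_comp_eq_localRep hf.smooth (hγs t ht) (mem_extChartAt_source (I := I) (γ t))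
    rw [hzero, map_zero, hx1 t ht] at h1
    obtain ⟨e, he⟩ := (hyΩ t ht).1.2
    refine (hyΩ t ht).2 (e.map_eq_zero_iff.1 ?_)
    have he' : (e : E →L[ℝ] (E →L[ℝ] ℝ)) (y t).2 = h (c t) (y t).2 := by rw [he]
    change (e : E →L[ℝ] (E →L[ℝ] ℝ)) (y t).2 = 0
    rw [he']
    ext z
    rw [hh, pullMetric_apply, h1, map_zero]
    rfl
  · intro t ht
    have h1 := deriv_comp_eq_localRep hf.smooth (hγs t ht) (mem_extChartAt_source (I := I) (γ t))
    have h2 := hnl t ht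
    rw [h1] at h2
    rw [inducedMetric, localRep_extChartAt_self]
    exact h2

/-- Being a null geodesic depends only on germs; this allows the members of a chain of extensions to
be glued. -/
theorem IsNullGeodesicOn.of_eventuallyEq {γ : ℝ → N} {J : Set ℝ}
    (h : ∀ s ∈ J, ∃ (γ' : ℝ → N) (J' : Set ℝ), IsOpen J' ∧ s ∈ J' ∧ γ =ᶠ[nhds s] γ' ∧
      IsNullGeodesicOn I M a f γ' J') : IsNullGeodesicOn I M a f γ J := by
  refine ⟨fun s hs => ?_, fun s hs => ?_, fun s hs => ?_, fun s hs => ?_⟩ <;>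
    obtain ⟨γ', J', hJ', hs', heq, hγ'⟩ := h s hs
  · exact (((hγ'.smooth s hs').contMDiffAt (hJ'.mem_nhds hs')).congr_of_eventuallyEq
      heq).contMDiffWithinAt
  all_goals
    have e0 : γ s = γ' s := heq.self_of_nhds
    have e1 : extChartAt I (γ' s) ∘ γ =ᶠ[nhds s] extChartAt I (γ' s) ∘ γ' :=
      heq.fun_comp _
    rw [e0]
    simp only [e1.deriv.deriv_eq, e1.deriv_eq]
  · exact hγ'.geodesic s hs'
  · exact hγ'.velocity_ne_zero s hs'
  · exact hγ'.null s hs'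

/-- Every null geodesic extends to an inextendible one. -/
theorem exists_inextendible_extension {γ₀ : ℝ → N} {J₀ : Set ℝ} (hJ₀ : IsOpenInterval J₀)
    (hγ₀ : IsNullGeodesicOn I M a f γ₀ J₀) :
    ∃ (γ : ℝ → N) (J : Set ℝ), J₀ ⊆ J ∧ Set.EqOn γ γ₀ J₀ ∧
      IsInextendibleNullGeodesic I M a f γ J := by
  classical
  let α := {x : (ℝ → N) × Set ℝ // IsOpenInterval x.2 ∧ J₀ ⊆ x.2 ∧ Set.EqOn x.1 γ₀ J₀ ∧
    IsNullGeodesicOn I M a f x.1 x.2}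
  -- Only a preorder, since the values of a curve outside its interval are arbitrary; Zorn's lemma
  -- is used in the form for transitive relations.
  let R : α → α → Prop := fun x y => x.1.2 ⊆ y.1.2 ∧ Set.EqOn y.1.1 x.1.1 x.1.2
  let x₀ : α := ⟨(γ₀, J₀), hJ₀, subset_rfl, fun _ _ => rfl, hγ₀⟩
  have htrans : ∀ {x y z : α}, R x y → R y z → R x z := fun hxy hyz =>
    ⟨hxy.1.trans hyz.1, fun s hs => (hyz.2 (hxy.1 hs)).trans (hxy.2 hs)⟩
  obtain ⟨m, hm⟩ := exists_maximal_of_chains_bounded (r := R) (fun C hC => by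
    rcases C.eq_empty_or_nonempty with rfl | ⟨x₁, hx₁⟩
    · exact ⟨x₀, fun x hx => hx.elim⟩
    have hcmp : ∀ x ∈ C, ∀ y ∈ C, R x y ∨ R y x := by
      intro x hx y hy
      rcases eq_or_ne x y with rfl | hne
      · exact Or.inl ⟨subset_rfl, fun _ _ => rfl⟩
      · exact hC hx hy hne
    -- The choice of the member of the chain is immaterial, because comparable members agree on the
    -- smaller interval.
    let γ : ℝ → N := fun s => if h : ∃ x ∈ C, s ∈ x.1.2 then h.choose.1.1 s else γ₀ s
    have hγ : ∀ x ∈ C, Set.EqOn γ x.1.1 x.1.2 := by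
      intro x hx s hs
      have h : ∃ x ∈ C, s ∈ x.1.2 := ⟨x, hx, hs⟩
      have hγs : γ s = h.choose.1.1 s := dif_pos h
      rw [hγs]
      rcases hcmp x hx _ h.choose_spec.1 with h1 | h1
      · exact h1.2 hs
      · exact (h1.2 h.choose_spec.2).symm
    refine ⟨⟨(γ, ⋃ x ∈ C, x.1.2), ⟨?_, ?_, ?_⟩, ?_, ?_, ?_⟩, fun x hx => ⟨?_, hγ x hx⟩⟩
    · exact isOpen_biUnion fun x _ => x.2.1.1
    · refine ⟨fun s hs t ht => ?_⟩
      simp only [Set.mem_iUnion, exists_prop] at hs ht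
      obtain ⟨x, hx, hs⟩ := hs
      obtain ⟨y, hy, ht⟩ := ht
      rcases hcmp x hx y hy with h | h
      · exact (y.2.1.2.1.out (h.1 hs) ht).trans (Set.subset_biUnion_of_mem (u := fun x : α => x.1.2) hy)
      · exact (x.2.1.2.1.out hs (h.1 ht)).trans (Set.subset_biUnion_of_mem (u := fun x : α => x.1.2) hx)
    · obtain ⟨s, hs⟩ := x₁.2.1.2.2
      exact ⟨s, Set.mem_biUnion hx₁ hs⟩
    · exact x₁.2.2.1.trans (Set.subset_biUnion_of_mem (u := fun x : α => x.1.2) hx₁)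
    · exact fun s hs => (hγ x₁ hx₁ (x₁.2.2.1 hs)).trans (x₁.2.2.2.1 hs)
    · refine IsNullGeodesicOn.of_eventuallyEq fun s hs => ?_
      simp only [Set.mem_iUnion, exists_prop] at hs
      obtain ⟨x, hx, hs⟩ := hs
      exact ⟨x.1.1, x.1.2, x.2.1.1, hs,
        Filter.eventually_of_mem (x.2.1.1.mem_nhds hs) (hγ x hx), x.2.2.2.2⟩
    · exact Set.subset_biUnion_of_mem (u := fun x : α => x.1.2) hx) htrans
  refine ⟨m.1.1, m.1.2, m.2.2.1, m.2.2.2.1, m.2.1, m.2.2.2.2, ?_⟩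
  intro γ' J' hJ' hsub heq hγ'
  exact subset_antisymm (hm ⟨(γ', J'), hJ', m.2.2.1.trans hsub,
    fun s hs => (heq (m.2.2.1 hs)).trans (m.2.2.2.1 hs), hγ'⟩ ⟨hsub, heq⟩).1 hsub

/-- In a complete umbilical timelike hypersurface with compactly bounded quotient, null vectors are
tangent to the spheres of constant radius. -/
theorem dr_null_eq_zero [FiniteDimensional ℝ E] (haM : |a| < M) (hf : IsImmersedIn I M a f)
    (ht : IsTimelike I M a f) (hu : IsUmbilical I M a f) (hb : HasCompactlyBoundedQuotient M a f)
    (hc : IsNullGeodesicallyComplete I M a f) (p : N) {v : E} (hv : v ≠ 0)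
    (hnull : inducedMetric I M a f p (extChartAt I p p) v v = 0) :
    dr (f p) (fderiv ℝ (localRep I f p) (extChartAt I p p) v) = 0 := by
  obtain ⟨ε, hε, γ₀, hp, hvel, hγ₀⟩ := exists_local_nullGeodesic haM hf ht p hv hnull
  have h0 : (0 : ℝ) ∈ Set.Ioo (-ε) ε := ⟨by linarith, hε⟩
  obtain ⟨γ, J, hJ, heq, hγ⟩ := exists_inextendible_extension
    ⟨isOpen_Ioo, Set.ordConnected_Ioo, ⟨0, h0⟩⟩ hγ₀
  obtain rfl := hc γ J hγ
  have h := dr_null_velocity_eq_zero haM hf ht hu hb hγ.2.1 0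
  have hev : γ =ᶠ[nhds 0] γ₀ := Filter.eventually_of_mem (isOpen_Ioo.mem_nhds h0) heq
  have e0 : γ 0 = p := by rw [heq h0, hp]
  rw [e0, (hev.fun_comp (extChartAt I p)).deriv_eq, hvel] at h
  exact h

/-- A complete umbilical timelike hypersurface with compactly bounded quotient is tangent to the
hypersurfaces of constant radius. -/
theorem dr_tangent_eq_zero [FiniteDimensional ℝ E] (haM : |a| < M) (hf : IsImmersedIn I M a f)
    (ht : IsTimelike I M a f) (hu : IsUmbilical I M a f) (hb : HasCompactlyBoundedQuotient M a f)
    (hc : IsNullGeodesicallyComplete I M a f) (p : N) (v : E) :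
    dr (f p) (fderiv ℝ (localRep I f p) (extChartAt I p p) v) = 0 := by
  obtain ⟨e, he⟩ := ht p
  set D := fderiv ℝ (localRep I f p) (extChartAt I p p) with hD
  have hb' : ∀ v w, inducedMetric I M a f p (extChartAt I p p) v w
      = pullMetric M a (localRep I f p) (extChartAt I p p) v w := fun _ _ => rfl
  generalize pullMetric M a (localRep I f p) (extChartAt I p p) = b at hb'
  simp only [hb'] at he
  -- The vectors `e 0 ± e i` are null and nonzero, so `dr` annihilates them; three of them already
  -- span the tangent space.
  have key : ∀ (i : Fin 3) (η : ℝ), i ≠ 0 → η * η = 1 →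
      dr (f p) (D (e 0)) + η * dr (f p) (D (e i)) = 0 := by
    intro i η hi hη
    rw [← dr_smul, ← map_smul, ← dr_add, ← map_add]
    refine dr_null_eq_zero haM hf ht hu hb hc p (fun h => ?_) ?_
    · have h1 : b (e 0 + η • e i) (e 0) = 0 := by
        rw [h]; simp
      simp [he, hi] at h1
    · rw [hb']
      simp [he, hi, hi.symm]
      linarith
  have h1 := key 1 1 (by simp) (by norm_num)
  have h2 := key 1 (-1) (by simp) (by norm_num)
  have h3 := key 2 1 (by simp) (by norm_num)
  have hz : ∀ i, dr (f p) (D (e i)) = 0 := by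
    intro i
    fin_cases i <;> simp <;> linarith
  rw [← e.sum_repr v]
  simp only [Fin.sum_univ_three, map_add, map_smul, dr_add, dr_smul, hz, mul_zero, add_zero]

end Hypersurface

/-! ### Hypersurfaces of constant radius are not umbilical -/

/-- The witness is `r sin ϑ ∂_ϑ`, which is regular in these coordinates and isolates the term `ρ²
dϑ²` of the metric. -/
theorem exists_polar_vector {p : Spacetime} (hp : 0 < p.2 0 ^ 2 + p.2 1 ^ 2) :
    ∃ U : Spacetime, U.1 = 0 ∧ dr p U = 0 ∧ sinSqDphi p U = 0 ∧ roundMetric p U U ≠ 0 := by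
  have hr : 0 < radius p := by
    have := radius_sq p
    have h2 : 0 < radius p ^ 2 := by nlinarith [sq_nonneg (p.2 2)]
    refine lt_of_le_of_ne (norm_nonneg _) fun h => ?_
    rw [show radius p = 0 from h.symm] at h2
    simp at h2
  refine ⟨(0, !₂[p.2 0 * p.2 2, p.2 1 * p.2 2, -(p.2 0 ^ 2 + p.2 1 ^ 2)]), rfl, ?_, ?_, ?_⟩
  · simp [dr, inner_eq]; left; ring
  · simp [sinSqDphi]; left; ring
  · have h : dr p (0, !₂[p.2 0 * p.2 2, p.2 1 * p.2 2, -(p.2 0 ^ 2 + p.2 1 ^ 2)]) = 0 := by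
      simp [dr, inner_eq]; left; ring
    rw [roundMetric, h, mul_zero, sub_zero]
    refine (div_pos ?_ (pow_pos hr 2)).ne'
    rw [inner_eq]
    simp
    nlinarith [mul_self_nonneg (p.2 0 * p.2 2), mul_self_nonneg (p.2 1 * p.2 2), mul_pos hp hp]

/-- Off the axis, the restrictions of the Kerr metric and of its Lie derivative along `r ∂_r` to
the level sets of the radius are not proportional. -/
theorem lieScaling_not_proportional {M a : ℝ} (ha : a ≠ 0) (haM : |a| < M) {p : Spacetime}
    (hD : p ∈ DOC M a) (hp : 0 < p.2 0 ^ 2 + p.2 1 ^ 2) (c : ℝ)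
    (hc : ∀ V W, dr p V = 0 → dr p W = 0 → lieScaling M a p V W = c * metric M a p V W) :
    False := by
  have hr := radius_pos haM hD
  have hMr := radius_gt_mass haM hD
  have hM := mass_pos haM
  have hρ := rhoSq_pos (a := a) hr
  obtain ⟨U, hU1, hU2, hU3, hU4⟩ := exists_polar_vector hp
  -- Two components suffice: the polar one gives `c ρ² = 2r²`, and the mixed one of `∂_t`, `∂_φ`,
  -- after division by a nonzero multiple of `a sin² ϑ`, gives `c ρ² = ρ² - 2r²`.
  have h1 := hc U U hU2 hU2
  have h2 := hc timeField (axialField p) dr_timeField dr_axialField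
  rw [metric_comm, metric_timeField] at h2
  rw [lieScaling, metric_eq, hU1, hU2, hU3] at h1
  rw [lieScaling, roundMetric_axialField, sinSqDphi_timeField, sinSqDphi_axialField, dr_timeField] at h2
  have e1 : (timeField : Spacetime).1 = 1 := rfl
  have e2 : (axialField p).1 = 0 := rfl
  simp only [e1, e2, mul_zero, zero_mul, add_zero, sub_zero, zero_sub] at h2
  set S := (p.2 0 ^ 2 + p.2 1 ^ 2) / radius p ^ 2 with hS
  have hSpos : 0 < S := by positivity
  have h3 : 2 * radius p ^ 2 = c * rhoSq a p := by
    have : 2 * radius p ^ 2 * roundMetric p U U = c * rhoSq a p * roundMetric p U U := by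
      linear_combination h1
    exact mul_right_cancel₀ hU4 this
  have h4 : rhoSq a p - 2 * radius p ^ 2 = c * rhoSq a p := by
    have hk : 2 * M * radius p * a * S / rhoSq a p ^ 2 ≠ 0 := by positivity
    have : 2 * M * radius p * a * S / rhoSq a p ^ 2 * (rhoSq a p - 2 * radius p ^ 2)
        = 2 * M * radius p * a * S / rhoSq a p ^ 2 * (c * rhoSq a p) := by
      have e3 : 2 * M * radius p / rhoSq a p
          = 2 * M * radius p / rhoSq a p ^ 2 * rhoSq a p := by field_simp
      linear_combination -h2 + c * a * S * e3
    exact mul_left_cancel₀ hk this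
  -- The two values of `c ρ²` give `ρ² = 4r²`, contrary to `ρ² ≤ r² + a² < 2r²`.
  have h5 := rhoSq_axial a hr
  rw [← hS] at h5
  have h6 : a ^ 2 < radius p ^ 2 := sq_lt_sq' (by linarith [neg_abs_le a]) (by linarith [le_abs_self a])
  have h7 : 0 < a ^ 2 * S := by positivity
  nlinarith

/-- The one-form `dr` as a continuous linear form. -/
def drCLM (p : Spacetime) : Spacetime →L[ℝ] ℝ :=
  LinearMap.toContinuousLinearMap
    { toFun := dr p, map_add' := dr_add p, map_smul' := dr_smul p }

/-- An injective linear map from a three-dimensional space into the kernel of `dr` is onto this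
kernel. -/
theorem exists_eq_of_dr_eq_zero {E : Type*} [NormedAddCommGroup E] [NormedSpace ℝ E]
    (hE : Module.finrank ℝ E = 3) {p : Spacetime} (hp : 0 < radius p) {D : E →L[ℝ] Spacetime}
    (hD : Function.Injective D) (hdr : ∀ v, dr p (D v) = 0) {V : Spacetime} (hV : dr p V = 0) :
    ∃ v, D v = V := by
  have hfin : FiniteDimensional ℝ E := Module.finite_of_finrank_pos (by omega)
  have h1 : Module.finrank ℝ (LinearMap.range D.toLinearMap) = 3 := by
    rw [LinearMap.finrank_range_of_inj hD, hE]
  have h2 : Module.finrank ℝ (LinearMap.ker (drCLM p).toLinearMap) = 3 := by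
    have h3 := LinearMap.finrank_range_add_finrank_ker (drCLM p).toLinearMap
    have h4 : LinearMap.range (drCLM p).toLinearMap = ⊤ := by
      refine LinearMap.range_eq_top.2 (LinearMap.surjective (fun h => ?_))
      have h5 : dr p (scalingField p) = 0 := LinearMap.congr_fun h (scalingField p)
      rw [dr_scalingField hp] at h5
      exact hp.ne' h5
    rw [h4, finrank_top] at h3
    simp at h3
    omega
  have h3 : LinearMap.range D.toLinearMap = LinearMap.ker (drCLM p).toLinearMap := by
    refine Submodule.eq_of_le_of_finrank_eq ?_ (h1.trans h2.symm)
    rintro _ ⟨v, rfl⟩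
    exact hdr v
  have h4 : V ∈ LinearMap.ker (drCLM p).toLinearMap := hV
  rw [← h3] at h4
  exact h4

section Hypersurface

variable {E : Type*} [NormedAddCommGroup E] [NormedSpace ℝ E]
  {H : Type*} [TopologicalSpace H] {I : ModelWithCorners ℝ E H} [I.Boundaryless]
  {N : Type*} [TopologicalSpace N] [ChartedSpace H N] [IsManifold I ∞ N]
  {M a : ℝ} {f : N → Spacetime}

/-- The second fundamental form of a hypersurface of constant radius along `r ∂_r`. -/
theorem secondFundamentalForm_scalingField (haM : |a| < M) (hf : IsImmersedIn I M a f)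
    (hdr : ∀ (q : N) (v : E), dr (f q) (fderiv ℝ (localRep I f q) (extChartAt I q q) v) = 0)
    (p : N) (v w : E) :
    secondFundamentalForm I M a f p (scalingField (f p)) v w
      = -(lieScaling M a (f p) (fderiv ℝ (localRep I f p) (extChartAt I p p) v)
          (fderiv ℝ (localRep I f p) (extChartAt I p p) w)) / 2 := by
  set F := localRep I f p with hF
  set u := extChartAt I p p with hu
  have hD := hf.mem_DOC
  have hG := differentiableAt_metricCLM haM (hD p)
  have hφ : ContDiffAt ℝ ∞ F u := contDiffAt_localRep_self hf.smooth p
  have hFu : F u = f p := localRep_extChartAt_self p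
  -- Orthogonality to `r ∂_r` is needed on a neighbourhood in one fixed chart in order to be
  -- differentiated, whereas `hdr` speaks of the centre of each chart; a change of charts bridges
  -- the two.
  have hev : ∀ z : E, ∀ᶠ y in nhds u, metricCLM M a (F y) (fderiv ℝ F y z) (scalingField (F y)) = 0 := by
    intro z
    filter_upwards [(isOpen_extChartAt_target (I := I) p).mem_nhds (mem_extChartAt_target p)]
      with y hy
    obtain ⟨T, hT⟩ := exists_fderiv_localRep_eq hf.smooth hy
      (mem_extChartAt_source (I := I) ((extChartAt I p).symm y))
    have h1 : dr (F y) (fderiv ℝ F y z) = 0 := by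
      rw [hT]; exact hdr _ _
    have h2 : F y ∈ DOC M a := hD _
    rw [metricCLM_apply, metric_scalingField M a (radius_pos haM h2), h1]
    simp
  -- The derivative of `g(dF(w), r ∂_r) = 0` in the direction `v`. Adding the version with `v` and
  -- `w` exchanged produces the Christoffel and Lie derivative terms.
  have key : ∀ v w : E,
      fderiv ℝ (metricCLM M a) (f p) (fderiv ℝ F u v) (fderiv ℝ F u w) (scalingField (f p))
        + metricCLM M a (f p) (fderiv ℝ (fderiv ℝ F) u v w) (scalingField (f p))
        + metricCLM M a (f p) (fderiv ℝ F u w) (scalingField (fderiv ℝ F u v)) = 0 := by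
    intro v w
    have hline : HasDerivAt (fun τ : ℝ => u + τ • v) v 0 := by
      simpa using ((hasDerivAt_id (0 : ℝ)).smul_const v).const_add u
    have e0 : u + (0 : ℝ) • v = u := by simp
    have hcl : ContDiffAt ℝ ∞ (fun τ : ℝ => u + τ • v) 0 :=
      (contDiff_const.add (contDiff_id.smul contDiff_const)).contDiffAt
    have hφ' : ContDiffAt ℝ ∞ F ((fun τ : ℝ => u + τ • v) 0) := by
      change ContDiffAt ℝ ∞ F (u + (0 : ℝ) • v)
      rwa [e0]
    have hb1 := hasDerivAt_fderiv_comp hφ' hcl (hasDerivAt_const 0 w)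
    have hb2 := (eventually_hasDerivAt_comp hφ' hcl).self_of_nhds
    have hb3 : HasDerivAt (fun τ : ℝ => scalingField (F (u + τ • v)))
        (scalingField (fderiv ℝ F (u + (0 : ℝ) • v) (deriv (fun τ : ℝ => u + τ • v) 0))) 0 :=
      scalingField.hasFDerivAt.comp_hasDerivAt (0 : ℝ) hb2
    have hb := hasDerivAt_bilin (G := metricCLM M a) (x := F ∘ fun τ : ℝ => u + τ • v)
      (by
        change DifferentiableAt ℝ _ (F (u + (0 : ℝ) • v))
        rw [e0, hFu]; exact hG)
      hb2 hb1 hb3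
    have hz : (fun τ : ℝ => metricCLM M a ((F ∘ fun τ : ℝ => u + τ • v) τ)
        (fderiv ℝ F (u + τ • v) w) (scalingField (F (u + τ • v)))) =ᶠ[nhds 0] fun _ => 0 := by
      have hc : Filter.Tendsto (fun τ : ℝ => u + τ • v) (nhds 0) (nhds u) := by
        have := hcl.continuousAt
        unfold ContinuousAt at this
        simpa only [e0] using this
      exact hc.eventually (hev w)
    have h0 := hb.unique ((hasDerivAt_const (0 : ℝ) (0 : ℝ)).congr_of_eventuallyEq hz)
    simp only [hline.deriv, e0, Function.comp_apply, hFu, map_zero, add_zero] at h0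
    exact h0
  have h1 := key v w
  have h2 := key w v
  rw [fderiv_fderiv_symm hφ w v] at h2
  have h3 := fderiv_metric_scalingField haM (hD p) (fderiv ℝ F u v) (fderiv ℝ F u w)
  rw [metricCLM_comm M a (f p) (scalingField (fderiv ℝ F u v))] at h3
  rw [secondFundamentalForm, christoffelFirst_eq (g := metric M a) (G := metricCLM M a)
    (fun _ _ _ => rfl) hG, ← h3, ← metricCLM_apply]
  simp only [← hF, ← hu]
  linarith

/-- No piece off the axis of a hypersurface of constant radius is umbilical. -/
theorem not_isUmbilical_of_dr_eq_zero (ha : a ≠ 0) (haM : |a| < M)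
    (hE : Module.finrank ℝ E = 3) (hf : IsImmersedIn I M a f)
    (hdr : ∀ (q : N) (v : E), dr (f q) (fderiv ℝ (localRep I f q) (extChartAt I q q) v) = 0)
    {p : N} (hp : 0 < (f p).2 0 ^ 2 + (f p).2 1 ^ 2) : ¬ IsUmbilical I M a f := by
  intro hu
  have hD := hf.mem_DOC p
  have hr := radius_pos haM hD
  obtain ⟨c, hc⟩ := hu p (scalingField (f p)) (fun v => by
    rw [metric_scalingField M a hr, hdr]; simp)
  refine lieScaling_not_proportional ha haM hD hp (-2 * c) fun V W hV hW => ?_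
  obtain ⟨v, rfl⟩ := exists_eq_of_dr_eq_zero hE hr (fderiv_localRep_injective hf p) (hdr p) hV
  obtain ⟨w, rfl⟩ := exists_eq_of_dr_eq_zero hE hr (fderiv_localRep_injective hf p) (hdr p) hW
  have h := hc v w
  rw [secondFundamentalForm_scalingField haM hf hdr, inducedMetric, localRep_extChartAt_self] at h
  linarith

/-- A hypersurface of constant radius is not contained in the axis. -/
theorem exists_off_axis [Nonempty N] (haM : |a| < M)
    (hE : Module.finrank ℝ E = 3) (hf : IsImmersedIn I M a f)
    (hdr : ∀ (q : N) (v : E), dr (f q) (fderiv ℝ (localRep I f q) (extChartAt I q q) v) = 0) :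
    ∃ p, 0 < (f p).2 0 ^ 2 + (f p).2 1 ^ 2 := by
  by_contra! h
  have h0 : ∀ p, (f p).2 0 = 0 := fun p => by
    have := h p
    have h1 : (f p).2 0 ^ 2 = 0 := by nlinarith [sq_nonneg ((f p).2 0), sq_nonneg ((f p).2 1)]
    exact pow_eq_zero_iff two_ne_zero |>.1 h1
  obtain ⟨p⟩ := ‹Nonempty N›
  -- At a point of the axis the first coordinate direction lies in the kernel of `dr`, hence is
  -- tangent to the hypersurface, although the first coordinate is supposed constant on it.
  obtain ⟨v, hv⟩ := exists_eq_of_dr_eq_zero hE (radius_pos haM (hf.mem_DOC p))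
    (fderiv_localRep_injective hf p) (hdr p) (V := (0, EuclideanSpace.single 0 1)) (by
      simp [dr, inner_eq, h0 p])
  have h1 := ((contDiffAt_localRep_self (I := I) hf.smooth p).differentiableAt
    (by simp)).hasFDerivAt
  set P : Spacetime →L[ℝ] ℝ := (EuclideanSpace.proj 0 : EuclideanSpace ℝ (Fin 3) →L[ℝ] ℝ).comp
    (ContinuousLinearMap.snd ℝ ℝ _) with hP
  have h2 := P.hasFDerivAt.comp _ h1
  have h3 : (P ∘ localRep I f p) = fun _ => 0 := by
    funext u
    exact h0 _
  rw [h3] at h2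
  have h4 := DFunLike.congr_fun (h2.unique (hasFDerivAt_const 0 _)) v
  rw [ContinuousLinearMap.comp_apply, hv] at h4
  simp [hP] at h4

end Hypersurface

/-! ### The cylinders `{r = r₀}` -/

theorem radius_cylinder {r₀ : ℝ} (hr₀ : 0 < r₀)
    (q : ℝ × Metric.sphere (0 : EuclideanSpace ℝ (Fin 3)) 1) : radius (cylinder r₀ q) = r₀ := by
  simp [radius, cylinder, norm_smul, abs_of_pos hr₀]

theorem isImmersedIn_cylinder {M a r₀ : ℝ} (haM : |a| < M) (hr₀ : horizonRadius M a < r₀) :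
    IsImmersedIn (𝓘(ℝ, ℝ).prod (𝓡 2)) M a (cylinder r₀) := by
  have hpos : 0 < r₀ := (mass_pos haM).trans (mass_lt_of_horizonRadius_lt haM hr₀)
  set L : EuclideanSpace ℝ (Fin 3) →L[ℝ] EuclideanSpace ℝ (Fin 3) :=
    r₀ • ContinuousLinearMap.id ℝ _ with hL
  have : Fact (Module.finrank ℝ (EuclideanSpace ℝ (Fin 3)) = 2 + 1) := ⟨by simp⟩
  have hsm : ContMDiff (𝓘(ℝ, ℝ).prod (𝓡 2)) 𝓘(ℝ, Spacetime) ∞ (cylinder r₀) := by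
    have h1 : ContMDiff (𝓘(ℝ, ℝ).prod (𝓡 2)) 𝓘(ℝ, EuclideanSpace ℝ (Fin 3)) ∞
        (fun q : ℝ × Metric.sphere (0 : EuclideanSpace ℝ (Fin 3)) 1 =>
          L (q.2 : EuclideanSpace ℝ (Fin 3))) :=
      L.contMDiff.comp
        ((contMDiff_coe_sphere (n := 2) (E := EuclideanSpace ℝ (Fin 3))).comp contMDiff_snd)
    exact contMDiff_fst.prodMk_space h1
  refine ⟨hsm, fun p => ?_, fun p => ?_⟩
  · have hc : HasMFDerivAt (𝓘(ℝ, ℝ).prod (𝓡 2)) 𝓘(ℝ, Spacetime) (cylinder r₀) p _ :=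
      ((hsm p).mdifferentiableAt (by simp)).hasMFDerivAt
    have hs : HasMFDerivAt (𝓡 2) 𝓘(ℝ, EuclideanSpace ℝ (Fin 3))
        (Subtype.val : Metric.sphere (0 : EuclideanSpace ℝ (Fin 3)) 1 → _) p.2
        (mfderiv (𝓡 2) 𝓘(ℝ, EuclideanSpace ℝ (Fin 3)) Subtype.val p.2) :=
      (contMDiff_coe_sphere (m := ∞) (n := 2) (E := EuclideanSpace ℝ (Fin 3)) p.2
        |>.mdifferentiableAt (by simp)).hasMFDerivAt
    have hinj : Function.Injective
        (mfderiv (𝓡 2) 𝓘(ℝ, EuclideanSpace ℝ (Fin 3))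
          (Subtype.val : Metric.sphere (0 : EuclideanSpace ℝ (Fin 3)) 1 → _) p.2) :=
      injective_mvfderiv_subtypeVal_sphere (n := 2) p.2
    have h1 := hasMFDerivAt_unique
      ((ContinuousLinearMap.fst ℝ ℝ (EuclideanSpace ℝ (Fin 3))).hasMFDerivAt.comp p hc)
      (hasMFDerivAt_fst (I := 𝓘(ℝ, ℝ)) (I' := 𝓡 2) p)
    have h2 := hasMFDerivAt_unique
      ((ContinuousLinearMap.snd ℝ ℝ (EuclideanSpace ℝ (Fin 3))).hasMFDerivAt.comp p hc)
      (L.hasMFDerivAt.comp p (hs.comp p (hasMFDerivAt_snd (I := 𝓘(ℝ, ℝ)) (I' := 𝓡 2) p)))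
    rw [injective_iff_map_eq_zero]
    intro v hv
    have h3 := DFunLike.congr_fun h1 v
    have h4 := DFunLike.congr_fun h2 v
    set D := mfderiv (𝓘(ℝ, ℝ).prod (𝓡 2)) 𝓘(ℝ, Spacetime) (cylinder r₀) p
    set S := mfderiv (𝓡 2) 𝓘(ℝ, EuclideanSpace ℝ (Fin 3))
      (Subtype.val : Metric.sphere (0 : EuclideanSpace ℝ (Fin 3)) 1 → _) p.2
    have h5 : (0 : ℝ) = v.1 := by
      have h6 : ContinuousLinearMap.fst ℝ ℝ (EuclideanSpace ℝ (Fin 3)) (D v) = v.1 := h3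
      rw [hv] at h6
      exact h6
    have h6 : (0 : EuclideanSpace ℝ (Fin 3)) = r₀ • S v.2 := by
      have h7 : ContinuousLinearMap.snd ℝ ℝ (EuclideanSpace ℝ (Fin 3)) (D v) = r₀ • S v.2 := h4
      rw [hv] at h7
      exact h7
    have h7 : S v.2 = 0 := (smul_eq_zero.1 h6.symm).resolve_left hpos.ne'
    exact Prod.ext h5.symm (hinj (h7.trans (map_zero S).symm))
  · change horizonRadius M a < radius _
    rwa [radius_cylinder hpos]

theorem dr_cylinder_eq_zero {M a r₀ : ℝ} (haM : |a| < M) (hr₀ : horizonRadius M a < r₀)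
    (q : ℝ × Metric.sphere (0 : EuclideanSpace ℝ (Fin 3)) 1) (v : ℝ × EuclideanSpace ℝ (Fin 2)) :
    dr (cylinder r₀ q) (fderiv ℝ (localRep (𝓘(ℝ, ℝ).prod (𝓡 2)) (cylinder r₀) q)
      (extChartAt (𝓘(ℝ, ℝ).prod (𝓡 2)) q q) v) = 0 := by
  have hf := isImmersedIn_cylinder haM hr₀
  have hpos : 0 < r₀ := (mass_pos haM).trans (mass_lt_of_horizonRadius_lt haM hr₀)
  set u := extChartAt (𝓘(ℝ, ℝ).prod (𝓡 2)) q q with hu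
  set F := localRep (𝓘(ℝ, ℝ).prod (𝓡 2)) (cylinder r₀) q with hF
  have hFu : F u = cylinder r₀ q := localRep_extChartAt_self q
  -- Valid for every `y`, even outside the chart target, because `F` factors through the cylinder.
  have hrad : ∀ y, radius (F y) = r₀ := fun y => radius_cylinder hpos _
  have hd : HasFDerivAt F (fderiv ℝ F u) u :=
    ((contDiffAt_localRep_self hf.smooth q).differentiableAt (by simp)).hasFDerivAt
  have hline : HasDerivAt (fun τ : ℝ => u + τ • v) v 0 := by
    simpa using ((hasDerivAt_id (0 : ℝ)).smul_const v).const_add u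
  have e0 : u + (0 : ℝ) • v = u := by simp
  have hx : HasDerivAt (fun τ : ℝ => F (u + τ • v)) (fderiv ℝ F u v) 0 := by
    refine HasFDerivAt.comp_hasDerivAt (f := fun τ : ℝ => u + τ • v) (l := F) 0 ?_ hline
    change HasFDerivAt F _ (u + (0 : ℝ) • v)
    rwa [e0]
  have h1 := hasDerivAt_radius (x := fun τ : ℝ => F (u + τ • v)) (s := 0)
    (by rw [hrad]; exact hpos) hx.differentiableAt
  simp only [hrad, hx.deriv, e0, hFu] at h1
  exact h1.unique (hasDerivAt_const _ _)

end Kerr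

end

theorem corollary2 (M a : ℝ) (ha : a ≠ 0) (haM : |a| < M) :
    (∀ (N : Type*) [TopologicalSpace N] [T2Space N] [SecondCountableTopology N] [Nonempty N]
        [ChartedSpace (EuclideanSpace ℝ (Fin 3)) N] [IsManifold (𝓡 3) ∞ N]
        (f : N → Kerr.Spacetime),
        ¬ (Kerr.IsImmersedIn (𝓡 3) M a f ∧ Kerr.IsTimelike (𝓡 3) M a f ∧
          Kerr.IsUmbilical (𝓡 3) M a f ∧ Kerr.IsNullGeodesicallyComplete (𝓡 3) M a f ∧
          Kerr.HasCompactlyBoundedQuotient M a f)) ∧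
    (∀ r₀ : ℝ, Kerr.horizonRadius M a < r₀ →
        ¬ Kerr.IsUmbilical (𝓘(ℝ, ℝ).prod (𝓡 2)) M a (Kerr.cylinder r₀)) := by
  constructor
  · rintro N _ _ _ _ _ _ f ⟨hf, ht, hu, hc, hb⟩
    have hE : Module.finrank ℝ (EuclideanSpace ℝ (Fin 3)) = 3 := by simp
    have hdr := Kerr.dr_tangent_eq_zero haM hf ht hu hb hc
    obtain ⟨p, hp⟩ := Kerr.exists_off_axis haM hE hf hdr
    exact Kerr.not_isUmbilical_of_dr_eq_zero ha haM hE hf hdr hp hu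
  · intro r₀ hr₀
    have hE : Module.finrank ℝ (ℝ × EuclideanSpace ℝ (Fin 2)) = 3 := by simp
    have hpos : 0 < r₀ :=
      (Kerr.mass_pos haM).trans (Kerr.mass_lt_of_horizonRadius_lt haM hr₀)
    -- The test point lies on the equator, away from the axis.
    refine Kerr.not_isUmbilical_of_dr_eq_zero ha haM hE (Kerr.isImmersedIn_cylinder haM hr₀)
      (Kerr.dr_cylinder_eq_zero haM hr₀) (p := (0, ⟨EuclideanSpace.single 0 1, by simp⟩)) ?_
    simp [Kerr.cylinder]
    positivity
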